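/- Let $d\ge 2$ and let $\mathbf k=(k_1,\dots,k_{d+1})$ be a sequence of positive integers. Let $M_{\mathbf k}$ be the $(d+1)\times(d+1)$ integer matrix with diagonal entries $k_i+1$, with entry $-k_{i+1}$ in row $i$ and column $i+1$ (indices cyclic modulo $d+1$, so the entry in row $d+1$, column $1$ is $-k_1$), and with all other entries $0$; put $D_{\mathbf k}=\det M_{\mathbf k}$. Let $w_i=(d+1)e_i-\sum_j e_j\in\mathbb R^{d+1}$ and $\widetilde w_i=\frac1{d+1}w_i$. Let $\mathcal L_{\mathbf k}$ (respectively $\widetilde{\mathcal L}_{\mathbf k}$) be the group of all $\sum_i a_iw_i$ (respectively $\sum_i a_i\widetilde w_i$) where $(a_1,\dots,a_{d+1})$ is an integer combination of the rows of $M_{\mathbf k}$. *The graph.* Let $\widetilde G_d$ be the graph of the $d$-dimensional permutahedral tiling: its vertices are the points $(\sigma(1),\dots,\sigma(d+1))+v$ with $\sigma$ a permutation of $\{1,\dots,d+1\}$ and $v$ an integer combination of $w_1,\dots,w_{d+1}$, and two vertices are adjacent if they differ by $e_j-e_i$ for some $i\ne j$. The generalized Heawood graph $H_{\mathbf k}$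 is the quotient of $\widetilde G_d$ by translations in $\mathcal L_{\mathbf k}$: its vertices and edges are the classes of vertices and of edges of $\widetilde G_d$ up to translation by vectors in $\mathcal L_{\mathbf k}$. *The complex.* The hyperplanes $x_j-x_i=m$ ($i\neq j$, $m\in\mathbb Z$) cut $V=\{x\in\mathbb R^{d+1}:\sum_i x_i=0\}$ into simplices, which form an infinite simplicial complex $\widetilde\Delta_d$ whose vertices are the points of the weight lattice $\{x\in V: x_j-x_i\in\mathbb Z \text{ for all } i,j\}$. Let $T_{\mathbf k}=\widetilde\Delta_d/\widetilde{\mathcal L}_{\mathbf k}$ be the complex of classes of faces of $\widetilde\Delta_d$ up to translation by vectors in $\widetilde{\mathcal L}_{\mathbf k}$. The *dual graph* of a simplicial complex is the graph on its facets in which two distinct facets are adjacent if they share a face of codimension $1$. **Theorem.** $T_{\mathbf k}$ is a finite simplicial complex: the vertices of each face of $\widetilde\Delta_d$ lie in distinct classes modulo $\widetilde{\mathcal L}_{\mathbf k}$, and two faces of $\widetilde\Delta_d$ have the same set of vertex classes if and only if they are translates of each other by a vector in $\widetilde{\mathcal L}_{\mathbf k}$. It is a triangulation of the $d$-dimensional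 torus, that is, its geometric realization is homeomorphic to $(\mathbb R/\mathbb Z)^d$. The graph $H_{\mathbf k}$ is isomorphic to the dual graph of $T_{\mathbf k}$ (in particular it has no loops and no multiple edges). Moreover $$D_{\mathbf k}=\det M_{\mathbf k}=\prod_{i=1}^{d+1}(k_i+1)-\prod_{i=1}^{d+1}k_i,$$ all faces of $T_{\mathbf k}$ have dimension at most $d$, and the $f$-vector $(f_0,\dots,f_d)$ of $T_{\mathbf k}$, where $f_i$ is the number of $i$-dimensional faces, is given by $$f_i=i!\,S(d+1,i+1)\,D_{\mathbf k}\qquad(0\le i\le d),$$ where $S(n,m)$ is the Stirling number of the second kind. In particular, $$f_0=D_{\mathbf k},\qquad f_{d-1}=\frac{(d+1)!}{2}\,D_{\mathbf k},\qquad f_d=d!\,D_{\mathbf k}.$$ -/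

import Mathlib

noncomputable section

namespace Heawood

/-! ### Abstract simplicial complexes -/

section Complexes

variable {ι : Type*}

/-- The points of the geometric realization of an abstract simplicial complex, in barycentric
coordinates: nonnegative functions supported on a face, with coordinate sum `1`. It carries the
subspace topology of `ι → ℝ`, which is the usual topology when the vertex set `ι` is finite. -/
def realization (K : AbstractSimplicialComplex ι) : Set (ι → ℝ) :=
  {x | (∀ v, 0 ≤ x v) ∧ ∃ s ∈ K.faces, (∀ v, v ∉ s → x v = 0) ∧ ∑ v ∈ s, x v = 1}

/-- The number `f_i` of faces of dimension `i` (faces with `i + 1` vertices). -/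
def fVector (K : AbstractSimplicialComplex ι) (i : ℕ) : ℕ :=
  Nat.card {s : Finset ι // s ∈ K.faces ∧ s.card = i + 1}

/-- The facets: the faces that are maximal under inclusion. -/
abbrev Facet (K : AbstractSimplicialComplex ι) : Type _ :=
  {s : Finset ι // Maximal (fun t => t ∈ K.faces) s}

/-- The dual graph: its vertices are the facets, and two different facets are adjacent if they
share a face of codimension one. -/
def dualGraph (K : AbstractSimplicialComplex ι) : SimpleGraph (Facet K) where
  Adj F G := F ≠ G ∧ ∃ r ∈ K.faces, r ⊆ F.1 ∧ r ⊆ G.1 ∧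
    r.card + 1 = F.1.card ∧ r.card + 1 = G.1.card
  symm := ⟨by
    rintro F G ⟨hne, r, hr, h1, h2, h3, h4⟩
    exact ⟨hne.symm, r, hr, h2, h1, h4, h3⟩⟩
  loopless := ⟨fun F h => h.1 rfl⟩

end Complexes

/-! ### Lattices -/

variable {d : ℕ}

/-- The vector `w_i = (d + 1) e_i - ∑_j e_j` of `ℝ^(d+1)`. -/
def w (d : ℕ) (i : Fin (d + 1)) : Fin (d + 1) → ℝ :=
  ((d : ℝ) + 1) • Pi.single i (1 : ℝ) - ∑ j, Pi.single j (1 : ℝ)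

/-- The vector `w_i / (d + 1)` of `ℝ^(d+1)`. -/
def wTilde (d : ℕ) (i : Fin (d + 1)) : Fin (d + 1) → ℝ :=
  ((d : ℝ) + 1)⁻¹ • w d i

/-- The integer combination `∑ a_i u_i` of given vectors `u_i`, as a homomorphism in `a`. -/
def intComb (u : Fin (d + 1) → Fin (d + 1) → ℝ) :
    (Fin (d + 1) → ℤ) →+ (Fin (d + 1) → ℝ) where
  toFun a := ∑ i, a i • u i
  map_zero' := by simp
  map_add' a b := by simp [add_smul, Finset.sum_add_distrib]

/-- The matrix `M_k`: the diagonal entries are `k_i + 1`, the entry in row `i` and column `i + 1`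
(cyclically) is `-k_{i+1}`, and all other entries vanish. -/
def M (k : Fin (d + 1) → ℕ) : Matrix (Fin (d + 1)) (Fin (d + 1)) ℤ :=
  Matrix.of fun i j => if j = i then (k j : ℤ) + 1 else if j = i + 1 then -(k j : ℤ) else 0

/-- `D_k = det M_k`. -/
def D (k : Fin (d + 1) → ℕ) : ℤ := (M k).det

/-- The integer combinations `b M_k` of the rows of `M_k`. -/
def rowLattice (k : Fin (d + 1) → ℕ) : AddSubgroup (Fin (d + 1) → ℤ) :=
  (Matrix.vecMulLinear (M k)).toAddMonoidHom.range

/-- The lattice of integer combinations of `w_1, …, w_{d+1}`. -/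
def tilingLattice (d : ℕ) : AddSubgroup (Fin (d + 1) → ℝ) := (intComb (w d)).range

/-- The sublattice of all `∑ a_i w_i` whose coefficient vector `a` is an integer combination of
the rows of `M_k`. -/
def tilingSublattice (k : Fin (d + 1) → ℕ) : AddSubgroup (Fin (d + 1) → ℝ) :=
  (rowLattice k).map (intComb (w d))

/-- The weight lattice: vectors of coordinate sum `0` all of whose coordinate differences are
integers. -/
def weightLattice (d : ℕ) : AddSubgroup (Fin (d + 1) → ℝ) where
  carrier := {x | ∑ i, x i = 0 ∧ ∀ i j, ∃ m : ℤ, x j - x i = m}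
  zero_mem' := ⟨by simp, fun _ _ => ⟨0, by simp⟩⟩
  add_mem' := by
    rintro x y ⟨hx, hx'⟩ ⟨hy, hy'⟩
    refine ⟨by simp [Finset.sum_add_distrib, hx, hy], fun i j => ?_⟩
    obtain ⟨m, hm⟩ := hx' i j
    obtain ⟨n, hn⟩ := hy' i j
    refine ⟨m + n, ?_⟩
    push_cast
    rw [← hm, ← hn]
    simp only [Pi.add_apply]
    ring
  neg_mem' := by
    rintro x ⟨hx, hx'⟩
    refine ⟨by simp [hx], fun i j => ?_⟩
    obtain ⟨m, hm⟩ := hx' i j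
    refine ⟨-m, ?_⟩
    push_cast
    rw [← hm]
    simp only [Pi.neg_apply]
    ring

/-- The sublattice of all `∑ a_i w_i / (d + 1)` whose coefficient vector `a` is an integer
combination of the rows of `M_k`. -/
def weightSublattice (k : Fin (d + 1) → ℕ) : AddSubgroup (Fin (d + 1) → ℝ) :=
  (rowLattice k).map (intComb (wTilde d))

/-! ### The generalized Heawood graph -/

/-- The vertices of the permutahedral tiling: all translates, by vectors of the lattice spanned by
the `w_i`, of the points whose coordinates are a permutation of `1, …, d + 1`. -/
abbrev TilingVertex (d : ℕ) : Type :=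
  {x : Fin (d + 1) → ℝ // ∃ σ : Equiv.Perm (Fin (d + 1)), ∃ v ∈ tilingLattice d,
    x = (fun i => ((σ i : ℕ) : ℝ) + 1) + v}

/-- The infinite graph of the permutahedral tiling: two of its vertices are adjacent if they
differ by a vector `e_j - e_i` with `i ≠ j`. -/
def tilingGraph (d : ℕ) : SimpleGraph (TilingVertex d) where
  Adj x y := ∃ i j : Fin (d + 1), i ≠ j ∧ y.1 - x.1 = Pi.single j 1 - Pi.single i 1
  symm := ⟨by
    rintro x y ⟨i, j, hij, h⟩
    exact ⟨j, i, hij.symm, by rw [← neg_sub, h, neg_sub]⟩⟩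
  loopless := ⟨by
    rintro x ⟨i, j, hij, h⟩
    have := congrFun h j
    simp [hij.symm] at this⟩

/-- Two vertices of the tiling are `k`-equivalent if they differ by a vector of the sublattice. -/
def vertexSetoid (k : Fin (d + 1) → ℕ) : Setoid (TilingVertex d) where
  r x y := ∃ v ∈ tilingSublattice k, y.1 = x.1 + v
  iseqv :=
    { refl := fun x => ⟨0, zero_mem _, by simp⟩
      symm := by
        rintro x y ⟨v, hv, h⟩
        exact ⟨-v, neg_mem hv, by simp [h]⟩
      trans := by
        rintro x y z ⟨v, hv, h⟩ ⟨u, hu, h'⟩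
        exact ⟨v + u, add_mem hv hu, by rw [h', h, add_assoc]⟩ }

/-- Two edges of the tiling graph are `k`-equivalent if one is the translate of the other by a
vector of the sublattice. -/
def edgeSetoid (k : Fin (d + 1) → ℕ) : Setoid (tilingGraph d).edgeSet where
  r e f := ∃ v ∈ tilingSublattice k, f.1.map Subtype.val = e.1.map (fun x => x.1 + v)
  iseqv :=
    { refl := fun e => ⟨0, zero_mem _, by simp only [add_zero]⟩
      symm := by
        rintro e f ⟨v, hv, h⟩
        refine ⟨-v, neg_mem hv, ?_⟩
        have := congrArg (Sym2.map (fun x => x + -v)) h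
        simp only [Sym2.map_map, Function.comp_def, add_neg_cancel_right] at this
        exact this.symm
      trans := by
        rintro e f g ⟨v, hv, h⟩ ⟨u, hu, h'⟩
        refine ⟨v + u, add_mem hv hu, ?_⟩
        have := congrArg (Sym2.map (fun x => x + u)) h
        simp only [Sym2.map_map, Function.comp_def, add_assoc] at this
        rw [h', this] }

/-- The vertices of the generalized Heawood graph: classes of vertices of the tiling graph. -/
abbrev HeawoodVertex (k : Fin (d + 1) → ℕ) : Type := Quotient (vertexSetoid k)

/-- The edges of the generalized Heawood graph: classes of edges of the tiling graph. -/
abbrev HeawoodEdge (k : Fin (d + 1) → ℕ) : Type := Quotient (edgeSetoid k)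

/-- The two ends of an edge of the generalized Heawood graph: the classes of the two ends of any
of its representatives. -/
def heawoodEnds (k : Fin (d + 1) → ℕ) : HeawoodEdge k → Sym2 (HeawoodVertex k) :=
  Quotient.lift (fun e : (tilingGraph d).edgeSet => e.1.map (Quotient.mk (vertexSetoid k))) (by
    rintro ⟨e, he⟩ ⟨f, hf⟩ ⟨v, hv, h⟩
    induction e using Sym2.ind with | _ x y
    induction f using Sym2.ind with | _ x' y'
    change s(x'.1, y'.1) = s(x.1 + v, y.1 + v) at h
    change s(_, _) = s(_, _)
    rw [Sym2.eq_iff] at h ⊢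
    rcases h with ⟨h1, h2⟩ | ⟨h1, h2⟩
    · exact Or.inl ⟨Quotient.sound ⟨v, hv, h1⟩, Quotient.sound ⟨v, hv, h2⟩⟩
    · exact Or.inr ⟨Quotient.sound ⟨v, hv, h2⟩, Quotient.sound ⟨v, hv, h1⟩⟩)

/-- The generalized Heawood graph `H_k`, the quotient of the tiling graph. A priori it might have
loops or multiple edges, so it is given as a multigraph. -/
def heawoodGraph (k : Fin (d + 1) → ℕ) : Graph (HeawoodVertex k) (HeawoodEdge k) where
  vertexSet := Set.univ
  IsLink e x y := heawoodEnds k e = s(x, y)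
  isLink_symm e _ := ⟨fun x y h => by rw [h, Sym2.eq_swap]⟩
  eq_or_eq_of_isLink_of_isLink e x y v u h h' := by
    rw [h, Sym2.eq_iff] at h'
    rcases h' with h' | h'
    · exact Or.inl h'.1
    · exact Or.inr h'.1
  left_mem_of_isLink _ _ _ _ := Set.mem_univ _

/-! ### The affine Coxeter arrangement and its quotient complex -/

/-- `p` lies in the hyperplane `∑ x_i = 0` and on none of the hyperplanes `x_j - x_i = m`
(`i ≠ j`, `m` an integer) of the affine Coxeter arrangement. -/
def IsGeneric (p : Fin (d + 1) → ℝ) : Prop :=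
  ∑ i, p i = 0 ∧ ∀ i j, i ≠ j → ∀ m : ℤ, p j - p i ≠ m

/-- The closure of the region of the affine Coxeter arrangement that contains the generic point
`p`. -/
def closedRegion (p : Fin (d + 1) → ℝ) : Set (Fin (d + 1) → ℝ) :=
  {x | ∑ i, x i = 0 ∧
    ∀ i j, (⌊p j - p i⌋ : ℝ) ≤ x j - x i ∧ x j - x i ≤ (⌊p j - p i⌋ : ℝ) + 1}

/-- Every point of the weight lattice lies in a closed region of the arrangement. -/
theorem exists_closedRegion (x : Fin (d + 1) → ℝ) (hx : x ∈ weightLattice d) :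
    ∃ p, IsGeneric p ∧ x ∈ closedRegion p := by
  obtain ⟨hx0, hxm⟩ := hx
  have hd : (0 : ℝ) < (d : ℝ) + 1 := by positivity
  let t : Fin (d + 1) → ℝ := fun i => ((i : ℕ) : ℝ) / ((d : ℝ) + 1)
  let c : ℝ := (∑ i, t i) / ((d : ℝ) + 1)
  have ht0 : ∀ i, 0 ≤ t i := fun i => by positivity
  have ht1 : ∀ i, t i < 1 := fun i => by
    rw [div_lt_one hd]
    exact_mod_cast i.2
  have htinj : ∀ i j, i ≠ j → t j - t i ≠ 0 := by
    intro i j hij h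
    apply hij
    have h2 : ((j : ℕ) : ℝ) = ((i : ℕ) : ℝ) := by
      have h3 : t j = t i := sub_eq_zero.mp h
      exact (div_left_inj' hd.ne').mp h3
    exact (Fin.ext (by exact_mod_cast h2)).symm
  have hdiff : ∀ i j, (x j + t j - c) - (x i + t i - c) = (x j - x i) + (t j - t i) := by
    intro i j
    ring
  refine ⟨fun i => x i + t i - c, ⟨?_, ?_⟩, hx0, ?_⟩
  · simp only [Finset.sum_sub_distrib, Finset.sum_add_distrib, hx0, Finset.sum_const,
      Finset.card_univ, Fintype.card_fin, nsmul_eq_mul, zero_add, c]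
    push_cast
    field_simp
    ring
  · intro i j hij m hm
    simp only [hdiff] at hm
    obtain ⟨n, hn⟩ := hxm i j
    rw [hn] at hm
    have h1 : t j - t i = ((m - n : ℤ) : ℝ) := by
      push_cast
      linarith
    have h2 : ((m - n : ℤ) : ℝ) < 1 := by linarith [ht0 i, ht1 j]
    have h3 : (-1 : ℝ) < ((m - n : ℤ) : ℝ) := by linarith [ht0 j, ht1 i]
    have h4 : m - n < 1 := by exact_mod_cast h2
    have h5 : -1 < m - n := by exact_mod_cast h3
    have h6 : m - n = 0 := by omega
    rw [h6] at h1
    exact htinj i j hij (by simpa using h1)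
  · intro i j
    simp only [hdiff]
    obtain ⟨n, hn⟩ := hxm i j
    rw [hn]
    have h1 : ⌊(n : ℝ) + (t j - t i)⌋ < n + 1 := by
      rw [Int.floor_lt]
      push_cast
      linarith [ht0 i, ht1 j]
    have h2 : n - 1 ≤ ⌊(n : ℝ) + (t j - t i)⌋ := by
      rw [Int.le_floor]
      push_cast
      linarith [ht0 j, ht1 i]
    constructor
    · exact_mod_cast Int.lt_add_one_iff.mp h1
    · have h3 : n ≤ ⌊(n : ℝ) + (t j - t i)⌋ + 1 := by omega
      exact_mod_cast h3

/-- The infinite simplicial complex of the affine Coxeter arrangement, with the points of the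
weight lattice as vertices: its faces are the faces of the simplices into which the arrangement
cuts the hyperplane `∑ x_i = 0`, each given by its set of vertices. -/
def affineComplex (d : ℕ) : AbstractSimplicialComplex (weightLattice d) where
  faces := {F | F.Nonempty ∧ ∃ p, IsGeneric p ∧ ∀ x ∈ F, x.1 ∈ closedRegion p}
  isRelLowerSet_faces := by
    rintro F ⟨hF, p, hp, h⟩
    exact ⟨hF, fun G hG hG' => ⟨hG', p, hp, fun x hx => h x (hG hx)⟩⟩
  singleton_mem x := by
    obtain ⟨p, hp, h⟩ := exists_closedRegion x.1 x.2
    exact ⟨Finset.singleton_nonempty x, p, hp, by simpa using h⟩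

/-- The vertices of the quotient complex: classes of the weight lattice modulo the sublattice. -/
abbrev TorusVertex (k : Fin (d + 1) → ℕ) : Type :=
  weightLattice d ⧸ (weightSublattice k).addSubgroupOf (weightLattice d)

/-- The class of a point of the weight lattice. -/
def toTorus (k : Fin (d + 1) → ℕ) (x : weightLattice d) : TorusVertex k := QuotientAddGroup.mk x

/-- Two faces are `k`-equivalent if one is the translate of the other by a vector of the
sublattice. -/
def FaceEquiv (k : Fin (d + 1) → ℕ) (F G : Finset (weightLattice d)) : Prop :=
  ∃ v ∈ weightSublattice k,
    (Subtype.val '' (G : Set (weightLattice d))) = (fun x => x.1 + v) '' (F : Set (weightLattice d))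

open Classical in
/-- The quotient complex `T_k`: the simplicial complex on the classes of the weight lattice whose
faces are the images of the faces of the complex of the affine arrangement. -/
def torusComplex (k : Fin (d + 1) → ℕ) : AbstractSimplicialComplex (TorusVertex k) where
  toPreAbstractSimplicialComplex :=
    (affineComplex d).toPreAbstractSimplicialComplex.map (toTorus k)
  singleton_mem v := by
    induction v using QuotientAddGroup.induction_on with
    | H x => exact ⟨{x}, (affineComplex d).singleton_mem x, by simp [toTorus]⟩

end Heawood

end

open Heawood

/-!
The weight lattice is `ℤ^(d+1)` modulo the constant vectors: an integer vector `a` stands for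
`∑ a_i w_i / (d + 1)` (`weightPoint`). The rows of `M_k` add up to `(1, …, 1)`, so the vertices of
the torus complex are the elements of `ℤ^(d+1)` modulo the row lattice (`torusPoint`), and their
number is the index `D_k` of that lattice. A simplex of the arrangement is a chain
`a, a + e_{i_0}, a + e_{i_0} + e_{i_1}, …`, given by a vector `a` and an order of the indices
(`exists_perm_of_mem_faces`, `mem_faces_of_below`); its image on the torus is a `cell`.

The arithmetic input is `const_of_mem_rowLattice`: a vector of the row lattice with entries in
`{-1, 0, 1}` is constant. Hence adding indicator vectors of proper subsets to a fixed vector gives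
different points of the torus (`ind_injOn_torus`). With one vertex fixed, faces of the torus complex
thus behave as faces of the infinite complex: their vertices are distinct, and equal vertex sets
differ by a translation (`injOn_toTorus`, `image_toTorus_eq_iff`).

* Faces with `i + 1` vertices that contain a given vertex correspond to flags of proper subsets,
  that is, to surjections from the `d + 1` indices onto `i + 1` elements (`exists_eq_cell`,
  `eq_of_cell_eq`). Counting pairs of a face and a vertex of it gives the `f`-vector.
* The barycenters of the cells, scaled by `d + 1` and translated by a constant vector, are the
  vertices of the tiling (`tilingPoint`). This gives the bijection between vertices of the Heawood
  graph and facets (`cell_eq_iff`). A step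
  along an edge of the tiling exchanges two unit vectors that are consecutive in the cyclic order
  defining a cell, that is, it changes one vertex of the cell. As `d + 1 ≥ 3`, edges with equivalent
  ends are translates of each other (`exists_translation_of_adj`), so there are no multiple edges.
* A real vector `x` is the average over `t` in the unit interval of the vectors obtained by rounding
  down `x + t (1, …, 1)`, and these roundings are vertices of one simplex. So the barycentric
  coordinates of `x` are the measures of sets of such `t` (`baryWeight`). They are continuous in
  `x`, take all values in the realization, and determine `x` up to the row lattice and constant
  vectors. Solving for the coefficients of the rows of `M_k` turns the space of the `x` modulo these
  vectors into `(ℝ / ℤ)^d`, and a continuous bijection from this compact space to the realization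
  is a homeomorphism.
-/

namespace Heawood

variable {d : ℕ}

/-! ### The determinant and the row lattice -/

theorem vecMul_M (hd : 1 ≤ d) (k : Fin (d + 1) → ℕ) (b : Fin (d + 1) → ℤ) (j : Fin (d + 1)) :
    Matrix.vecMul b (M k) j = b j + k j * (b j - b (j - 1)) := by
  have : NeZero d := ⟨by omega⟩
  have h1 : (j - 1 : Fin (d + 1)) ≠ j := by
    intro h
    simp at h
  have h3 : ∀ i, b i * M k i j = (if i = j then b j * (k j + 1) else 0) +
      (if i = j - 1 then - (b (j - 1) * k j) else 0) := by
    intro i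
    simp only [M, Matrix.of_apply]
    by_cases hij : j = i
    · subst hij
      simp [h1.symm]
    · by_cases hij' : j = i + 1
      · have : i = j - 1 := by rw [hij']; simp
        subst this
        rw [if_neg h1.symm, if_neg h1, if_pos rfl, if_pos (by simp)]
        ring
      · have : i ≠ j - 1 := fun h => hij' (by rw [h]; simp)
        simp [hij, hij', this, Ne.symm hij]
  simp only [Matrix.vecMul, dotProduct, h3, Finset.sum_add_distrib, Finset.sum_ite_eq',
    Finset.mem_univ, if_true]
  ring

theorem mem_rowLattice {k : Fin (d + 1) → ℕ} {v : Fin (d + 1) → ℤ} :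
    v ∈ rowLattice k ↔ ∃ b, Matrix.vecMul b (M k) = v := by
  rfl

theorem const_mem_rowLattice (hd : 1 ≤ d) (k : Fin (d + 1) → ℕ) (c : ℤ) :
    (fun _ => c) ∈ rowLattice k := by
  refine mem_rowLattice.2 ⟨fun _ => c, ?_⟩
  ext j
  rw [vecMul_M hd]
  simp

open Fin.NatCast in
/-- Induction backwards around the cycle of indices. -/
theorem forall_of_cyclic (p : Fin (d + 1) → Prop) (j₀ : Fin (d + 1)) (h₀ : p j₀)
    (h : ∀ j, p j → p (j - 1)) (j : Fin (d + 1)) : p j := by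
  have key : ∀ m : ℕ, p (j₀ - (m : Fin (d + 1))) := by
    intro m
    induction m with
    | zero => simpa using h₀
    | succ m ih =>
      have := h _ ih
      rwa [sub_sub, ← Nat.cast_succ] at this
  have := key (j₀ - j : Fin (d + 1)).val
  simpa using this

/-- The only vectors of the row lattice with all entries in `{-1, 0, 1}` are the constant ones.
If `b` is the coefficient vector and its maximum is positive, then the entry at an index where it is
attained forces the cyclically preceding coefficient to be maximal as well. -/
theorem const_of_mem_rowLattice (hd : 1 ≤ d) {k : Fin (d + 1) → ℕ} (hk : ∀ i, 0 < k i)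
    {v : Fin (d + 1) → ℤ} (hv : v ∈ rowLattice k) (h1 : ∀ i, |v i| ≤ 1) (i j : Fin (d + 1)) :
    v i = v j := by
  obtain ⟨b, rfl⟩ := mem_rowLattice.1 hv
  have hb : ∀ j, |b j + k j * (b j - b (j - 1))| ≤ 1 := fun j => by
    rw [← vecMul_M hd]; exact h1 j
  suffices h : ∃ c, ∀ j, b j = c by
    obtain ⟨c, hc⟩ := h
    simp [vecMul_M hd, hc]
  obtain ⟨jM, hM⟩ := Finite.exists_max b
  obtain ⟨jm, hm⟩ := Finite.exists_min b
  by_cases h : 1 ≤ b jM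
  · refine ⟨b jM, forall_of_cyclic _ jM rfl fun j hj => ?_⟩
    have h2 := (abs_le.1 (hb j)).2
    have h3 := hM (j - 1)
    have h4 : (1 : ℤ) ≤ k j := by exact_mod_cast hk j
    rw [hj] at h2
    nlinarith
  by_cases h' : b jm ≤ -1
  · refine ⟨b jm, forall_of_cyclic _ jm rfl fun j hj => ?_⟩
    have h2 := (abs_le.1 (hb j)).1
    have h3 := hm (j - 1)
    have h4 : (1 : ℤ) ≤ k j := by exact_mod_cast hk j
    rw [hj] at h2
    nlinarith
  · refine ⟨0, fun j => ?_⟩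
    have := hM j
    have := hm j
    omega

/-- Expansion along the first column: of the two minors that occur, one is upper triangular with
diagonal entries `k_i + 1`, the other is lower triangular with diagonal entries `-k_i`. -/
theorem D_eq (hd : 1 ≤ d) (k : Fin (d + 1) → ℕ) :
    D k = ∏ i, ((k i : ℤ) + 1) - ∏ i, (k i : ℤ) := by
  obtain ⟨e, rfl⟩ : ∃ e, d = e + 1 := ⟨d - 1, by omega⟩
  have hM0 : ∀ i : Fin (e + 1), i ≠ Fin.last e → M k i.succ 0 = 0 := by
    intro i hi
    have h1 : (0 : Fin (e + 2)) ≠ i.succ := (Fin.succ_ne_zero i).symm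
    have h2 : (0 : Fin (e + 2)) ≠ i.succ + 1 := by
      intro h
      have h3 : i.succ < Fin.last (e + 1) := by
        rw [← Fin.succ_last]; exact Fin.succ_lt_succ_iff.2 (Fin.lt_last_iff_ne_last.2 hi)
      have := congrArg Fin.val h
      rw [Fin.val_add_one_of_lt h3] at this
      simp at this
    simp only [M, Matrix.of_apply]
    rw [if_neg h1, if_neg h2]
  have hMl : M k (Fin.last e).succ 0 = -(k 0 : ℤ) := by
    have h1 : (0 : Fin (e + 2)) ≠ (Fin.last e).succ := (Fin.succ_ne_zero _).symm
    have h2 : (0 : Fin (e + 2)) = (Fin.last e).succ + 1 := by simp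
    simp only [M, Matrix.of_apply]
    rw [if_neg h1, if_pos h2]
  have hU : ((M k).submatrix Fin.succ Fin.succ).det = ∏ i : Fin (e + 1), ((k i.succ : ℤ) + 1) := by
    rw [Matrix.det_of_isUpperTriangular]
    · simp [M]
    · intro i j hij
      have hij : j < i := hij
      have h1 : j.succ ≠ i.succ := by simpa using hij.ne
      have h2 : j.succ ≠ i.succ + 1 := by
        intro h
        by_cases hl : i = Fin.last e
        · subst hl
          simp at h
        · have h3 : i.succ < Fin.last (e + 1) := by
            rw [← Fin.succ_last]; exact Fin.succ_lt_succ_iff.2 (Fin.lt_last_iff_ne_last.2 hl)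
          have := congrArg Fin.val h
          rw [Fin.val_add_one_of_lt h3] at this
          have := Fin.lt_def.1 hij
          simp at *
          omega
      simp only [M, Matrix.of_apply, Matrix.submatrix_apply]
      rw [if_neg h1, if_neg h2]
  have hL : ((M k).submatrix (Fin.last e).succ.succAbove Fin.succ).det =
      ∏ i : Fin (e + 1), (-(k i.succ : ℤ)) := by
    rw [Matrix.det_of_isLowerTriangular]
    · refine Finset.prod_congr rfl fun i _ => ?_
      have h1 : i.succ ≠ i.castSucc := by
        intro h; have := congrArg Fin.val h; simp at this
      have h2 : i.succ = i.castSucc + 1 := by simp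
      simp only [M, Matrix.of_apply, Matrix.submatrix_apply, Fin.succ_last, Fin.succAbove_last]
      rw [if_neg h1, if_pos h2]
    · intro i j hij
      have hij : i < j := hij
      have h1 : j.succ ≠ i.castSucc := by
        intro h; have := congrArg Fin.val h; have := Fin.lt_def.1 hij; simp at *; omega
      have h2 : j.succ ≠ i.castSucc + 1 := by
        intro h; have := congrArg Fin.val h; have := Fin.lt_def.1 hij; simp at *; omega
      simp only [M, Matrix.of_apply, Matrix.submatrix_apply, Fin.succ_last, Fin.succAbove_last]
      rw [if_neg h1, if_neg h2]
  rw [D, Matrix.det_succ_column_zero, Fin.sum_univ_succ, Finset.sum_eq_single (Fin.last e)]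
  · rw [hMl, hL, Fin.succAbove_zero, hU, Finset.prod_neg,
      Fin.prod_univ_succ (fun i => (k i : ℤ) + 1),
      Fin.prod_univ_succ (fun i => (k i : ℤ))]
    have h00 : M k 0 0 = (k 0 : ℤ) + 1 := by simp [M]
    rw [h00]
    have hs : ((-1 : ℤ) ^ (e + 1)) * (-1) ^ (e + 1) = 1 := by
      rw [← mul_pow]; simp
    simp only [Fin.val_zero, pow_zero, one_mul, Fin.val_succ, Fin.val_last, Finset.card_univ,
      Fintype.card_fin]
    linear_combination (-(k 0 : ℤ) * ∏ i : Fin (e + 1), (k i.succ : ℤ)) * hs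
  · intro i _ hi
    rw [hM0 i hi]; simp
  · simp

theorem D_pos (hd : 1 ≤ d) {k : Fin (d + 1) → ℕ} (hk : ∀ i, 0 < k i) : 0 < D k := by
  rw [D_eq hd, sub_pos]
  exact Finset.prod_lt_prod_of_nonempty (fun i _ => by exact_mod_cast hk i)
    (fun i _ => by linarith) Finset.univ_nonempty

theorem index_rowLattice (hd : 1 ≤ d) {k : Fin (d + 1) → ℕ} (hk : ∀ i, 0 < k i) :
    ((rowLattice k).index : ℤ) = D k := by
  have hinj : Function.Injective (Matrix.vecMulLinear (M k)) := by
    rw [← LinearMap.ker_eq_bot, LinearMap.ker_eq_bot']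
    intro b hb
    by_contra h
    exact (D_pos hd hk).ne' (Matrix.exists_vecMul_eq_zero_iff.1 ⟨b, h, hb⟩)
  have h := Submodule.natAbs_det_equiv (LinearMap.range (Matrix.vecMulLinear (M k)))
    (LinearEquiv.ofInjective (Matrix.vecMulLinear (M k)) hinj)
  have h2 : (rowLattice k).index = (D k).natAbs := by
    refine Eq.trans h.symm (congrArg Int.natAbs ?_)
    refine Eq.trans (congrArg LinearMap.det (?_ : _ = Matrix.toLin' (M k).transpose)) ?_
    · ext b j
      simp
    · rw [LinearMap.det_toLin', Matrix.det_transpose, D]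
  rw [h2]
  exact Int.natAbs_of_nonneg (D_pos hd hk).le

/-! ### Integer coordinates on the weight lattice and on its quotient -/

theorem intComb_wTilde_apply (a : Fin (d + 1) → ℤ) (i : Fin (d + 1)) :
    intComb (wTilde d) a i = a i - (∑ l, (a l : ℝ)) / (d + 1) := by
  have hd : (d : ℝ) + 1 ≠ 0 := by positivity
  have h : ∀ l, a l • wTilde d l i = (if l = i then (a l : ℝ) else 0) - (a l : ℝ) / (d + 1) := by
    intro l
    by_cases hl : l = i
    · subst hl
      simp [wTilde, w, Pi.single_apply]
      field_simp
      ring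
    · simp [wTilde, w, Pi.single_apply, hl, Ne.symm hl]
      field_simp
  change (∑ l, a l • wTilde d l) i = _
  rw [Finset.sum_apply]
  simp only [Pi.smul_apply, h, Finset.sum_sub_distrib, Finset.sum_div]
  simp

/-- The point `∑ a_i w_i / (d + 1)` of the weight lattice. Every point of the weight lattice has
this form, and `a` is determined up to adding a constant vector. -/
noncomputable def weightPoint (d : ℕ) : (Fin (d + 1) → ℤ) →+ weightLattice d :=
  (intComb (wTilde d)).codRestrict (weightLattice d) fun a => by
    have hd : (d : ℝ) + 1 ≠ 0 := by positivity
    refine ⟨?_, fun i j => ⟨a j - a i, ?_⟩⟩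
    · simp only [intComb_wTilde_apply, Finset.sum_sub_distrib, Finset.sum_const, Finset.card_univ,
        Fintype.card_fin, nsmul_eq_mul]
      push_cast
      field_simp
      ring
    · simp only [intComb_wTilde_apply]
      push_cast
      ring

theorem weightPoint_apply (a : Fin (d + 1) → ℤ) (i : Fin (d + 1)) :
    (weightPoint d a).1 i = a i - (∑ l, (a l : ℝ)) / (d + 1) :=
  intComb_wTilde_apply a i

theorem weightPoint_sub (a : Fin (d + 1) → ℤ) (i j : Fin (d + 1)) :
    (weightPoint d a).1 j - (weightPoint d a).1 i = a j - a i := by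
  simp [weightPoint_apply]

theorem weightLattice_ext {x y : weightLattice d}
    (h : ∀ i, x.1 i - x.1 0 = y.1 i - y.1 0) : x = y := by
  have hd : (d : ℝ) + 1 ≠ 0 := by positivity
  have h1 : ∀ i, x.1 i = y.1 i + (x.1 0 - y.1 0) := fun i => by linarith [h i]
  have h2 : ∑ i, x.1 i = ∑ i, (y.1 i + (x.1 0 - y.1 0)) := Finset.sum_congr rfl fun i _ => h1 i
  rw [Finset.sum_add_distrib, x.2.1, y.2.1] at h2
  have h3 : x.1 0 - y.1 0 = 0 := by
    have h4 : ((d : ℝ) + 1) * (x.1 0 - y.1 0) = 0 := by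
      simpa [mul_sub] using h2.symm
    exact (mul_eq_zero.1 h4).resolve_left hd
  ext i
  rw [h1, h3, add_zero]

theorem weightPoint_eq_iff {a b : Fin (d + 1) → ℤ} :
    weightPoint d a = weightPoint d b ↔ ∃ c : ℤ, ∀ i, a i = b i + c := by
  constructor
  · intro h
    refine ⟨a 0 - b 0, fun i => ?_⟩
    have h1 := weightPoint_sub a 0 i
    rw [h, weightPoint_sub] at h1
    have h2 : b i - b 0 = a i - a 0 := by exact_mod_cast h1
    linarith
  · rintro ⟨c, hc⟩
    refine weightLattice_ext fun i => ?_
    rw [weightPoint_sub, weightPoint_sub, hc, hc]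
    push_cast
    ring

theorem weightPoint_surjective : Function.Surjective (weightPoint d) := by
  intro x
  choose a ha using fun i => x.2.2 0 i
  refine ⟨a, weightLattice_ext fun i => ?_⟩
  rw [weightPoint_sub, ha, ← ha 0]
  simp

/-- The class modulo the sublattice of the point `∑ a_i w_i / (d + 1)` of the weight lattice. -/
noncomputable def torusPoint (k : Fin (d + 1) → ℕ) : (Fin (d + 1) → ℤ) →+ TorusVertex k :=
  (QuotientAddGroup.mk' _).comp (weightPoint d)

theorem toTorus_weightPoint (k : Fin (d + 1) → ℕ) (a : Fin (d + 1) → ℤ) :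
    toTorus k (weightPoint d a) = torusPoint k a := rfl

theorem weightPoint_mem_weightSublattice (hd : 1 ≤ d) {k : Fin (d + 1) → ℕ}
    {a : Fin (d + 1) → ℤ} : (weightPoint d a).1 ∈ weightSublattice k ↔ a ∈ rowLattice k := by
  constructor
  · rintro ⟨l, hl, h⟩
    have h : weightPoint d l = weightPoint d a := Subtype.ext h
    obtain ⟨c, hc⟩ := weightPoint_eq_iff.1 h.symm
    have : a = l + fun _ => c := funext hc
    rw [this]
    exact add_mem hl (const_mem_rowLattice hd k c)
  · exact fun h => ⟨a, h, rfl⟩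

theorem torusPoint_surjective (k : Fin (d + 1) → ℕ) : Function.Surjective (torusPoint k) :=
  (QuotientAddGroup.mk'_surjective _).comp weightPoint_surjective

theorem torusPoint_eq_zero_iff (hd : 1 ≤ d) {k : Fin (d + 1) → ℕ} {a : Fin (d + 1) → ℤ} :
    torusPoint k a = 0 ↔ a ∈ rowLattice k := by
  rw [← weightPoint_mem_weightSublattice hd]
  change (QuotientAddGroup.mk (weightPoint d a) : TorusVertex k) = 0 ↔ _
  rw [QuotientAddGroup.eq_zero_iff, AddSubgroup.mem_addSubgroupOf]

theorem torusPoint_eq_iff (hd : 1 ≤ d) {k : Fin (d + 1) → ℕ} {a b : Fin (d + 1) → ℤ} :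
    torusPoint k a = torusPoint k b ↔ a - b ∈ rowLattice k := by
  rw [← torusPoint_eq_zero_iff hd, map_sub, sub_eq_zero]

theorem torusPoint_const (hd : 1 ≤ d) (k : Fin (d + 1) → ℕ) (c : ℤ) :
    torusPoint k (fun _ => c) = 0 :=
  (torusPoint_eq_zero_iff hd).2 (const_mem_rowLattice hd k c)

theorem ker_torusPoint (hd : 1 ≤ d) (k : Fin (d + 1) → ℕ) : (torusPoint k).ker = rowLattice k := by
  ext a
  rw [AddMonoidHom.mem_ker, torusPoint_eq_zero_iff hd]

theorem card_torusVertex (hd : 1 ≤ d) {k : Fin (d + 1) → ℕ} (hk : ∀ i, 0 < k i) :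
    (Nat.card (TorusVertex k) : ℤ) = D k := by
  rw [← index_rowLattice hd hk, ← ker_torusPoint hd, AddSubgroup.index_ker,
    AddMonoidHom.range_eq_top.2 (torusPoint_surjective k)]
  simp

theorem finite_torusVertex (hd : 1 ≤ d) {k : Fin (d + 1) → ℕ} (hk : ∀ i, 0 < k i) :
    Finite (TorusVertex k) := by
  refine Nat.finite_of_card_ne_zero fun h => ?_
  have h1 := card_torusVertex hd hk
  have h2 := D_pos hd hk
  rw [h] at h1
  simp at h1
  omega

/-! ### Indicator vectors and flags of subsets -/

/-- The indicator vector of a set of indices. -/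
def ind (B : Finset (Fin (d + 1))) : Fin (d + 1) → ℤ := fun l => if l ∈ B then 1 else 0

@[simp] theorem ind_empty : ind (∅ : Finset (Fin (d + 1))) = 0 := by
  ext l; simp [ind]

/-- Adding indicator vectors of proper subsets of the set of indices to a vector gives distinct
points of the torus. -/
theorem ind_injOn_torus (hd : 1 ≤ d) {k : Fin (d + 1) → ℕ} (hk : ∀ i, 0 < k i)
    {B B' : Finset (Fin (d + 1))} (hB : B ≠ Finset.univ) (hB' : B' ≠ Finset.univ)
    (h : torusPoint k (ind B) = torusPoint k (ind B')) : B = B' := by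
  have h1 := const_of_mem_rowLattice hd hk ((torusPoint_eq_iff hd).1 h) (fun i => by
    simp only [Pi.sub_apply, ind]; split_ifs <;> simp)
  obtain ⟨l, hl⟩ : ∃ l, l ∉ B := by
    by_contra! h2; exact hB (Finset.eq_univ_iff_forall.2 h2)
  obtain ⟨l', hl'⟩ : ∃ l, l ∉ B' := by
    by_contra! h2; exact hB' (Finset.eq_univ_iff_forall.2 h2)
  simp only [Pi.sub_apply, ind] at h1
  ext i
  have h2 := h1 i l
  have h3 := h1 i l'
  simp only [hl, hl', if_false] at h2 h3
  by_cases hi : i ∈ B <;> by_cases hi' : i ∈ B' <;> by_cases hl1 : l ∈ B' <;>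
    by_cases hl2 : l' ∈ B <;> simp_all

/-- The sets of a flag: the indices with value less than `j`. -/
def below {m : ℕ} (g : Fin (d + 1) → Fin m) (j : ℕ) : Finset (Fin (d + 1)) :=
  Finset.univ.filter fun l => (g l : ℕ) < j

theorem mem_below {m : ℕ} {g : Fin (d + 1) → Fin m} {j : ℕ} {l : Fin (d + 1)} :
    l ∈ below g j ↔ (g l : ℕ) < j := by
  simp [below]

@[simp] theorem below_zero {m : ℕ} (g : Fin (d + 1) → Fin m) : below g 0 = ∅ := by
  ext l; simp [mem_below]

theorem below_mono {m : ℕ} (g : Fin (d + 1) → Fin m) : Monotone (below g) :=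
  fun _ _ h _ hl => mem_below.2 ((mem_below.1 hl).trans_le h)

theorem below_ne_univ {m : ℕ} {g : Fin (d + 1) → Fin m} (hg : Function.Surjective g) (j : Fin m) :
    below g j ≠ Finset.univ := by
  obtain ⟨l, rfl⟩ := hg j
  intro h
  have := Finset.mem_univ l
  rw [← h, mem_below] at this
  exact lt_irrefl _ this

theorem below_strictMono {m : ℕ} {g : Fin (d + 1) → Fin m} (hg : Function.Surjective g) :
    StrictMono fun j : Fin m => below g j := by
  intro j j' h
  refine lt_of_le_of_ne (below_mono g h.le) fun h1 => ?_
  obtain ⟨l, rfl⟩ := hg j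
  have h2 : l ∈ below g j' := mem_below.2 h
  rw [← show below g (g l) = below g j' from h1, mem_below] at h2
  exact lt_irrefl _ h2

theorem card_below (σ : Equiv.Perm (Fin (d + 1))) {j : ℕ} (hj : j ≤ d + 1) :
    (below σ j).card = j := by
  have : below σ j = (Finset.univ.filter fun r : Fin (d + 1) => (r : ℕ) < j).map
      σ.symm.toEmbedding := by
    ext l
    simp [mem_below, Finset.mem_map_equiv]
  rw [this, Finset.card_map, Fin.card_filter_val_lt]
  exact min_eq_right hj

/-- A flag determines the surjection that defines it. -/
theorem eq_of_below_eq {m : ℕ} {g g' : Fin (d + 1) → Fin m} (hg : Function.Surjective g)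
    (h : ∀ j : Fin m, ∃ j' : Fin m, below g j = below g' j') : g = g' := by
  choose τ hτ using h
  have hmono : StrictMono τ := by
    intro i j hij
    by_contra! h1
    have h2 := below_strictMono hg hij
    simp only [hτ] at h2
    exact not_lt_of_ge (below_mono g' (show (τ j : ℕ) ≤ τ i from h1)) h2
  have hid : ∀ j, τ j = j := by
    intro j
    have hb : Function.Bijective τ := Finite.injective_iff_bijective.1 hmono.injective
    have := Subsingleton.elim (hmono.orderIsoOfSurjective τ hb.2) (OrderIso.refl (Fin m))
    exact congrArg (fun f : Fin m ≃o Fin m => f j) this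
  simp only [hid] at hτ
  ext l
  have h1 : l ∉ below g (g l) := by simp [mem_below]
  have h2 : l ∉ below g' (g' l) := by simp [mem_below]
  rw [hτ, mem_below] at h1
  rw [← hτ, mem_below] at h2
  omega

/-- The indices can be ordered such that the entries of a given vector weakly decrease. -/
theorem exists_perm_antitone (q : Fin (d + 1) → ℝ) :
    ∃ σ : Equiv.Perm (Fin (d + 1)), ∀ i j, q j < q i → σ i < σ j := by
  refine ⟨(Tuple.sort fun i => - q i).symm, fun i j h => ?_⟩
  by_contra! h1
  have := Tuple.monotone_sort (fun i => - q i) h1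
  simp at this
  linarith

/-- A set that is initial in the order given by a permutation belongs to its flag. -/
theorem eq_below_card (σ : Equiv.Perm (Fin (d + 1))) {B : Finset (Fin (d + 1))}
    (h : ∀ i ∈ B, ∀ j ∉ B, σ i < σ j) : B = below σ B.card := by
  ext i
  rw [mem_below]
  constructor
  · intro hi
    have h1 : below σ (σ i + 1) ⊆ B := by
      intro l hl
      by_contra hlB
      have := Fin.lt_def.1 (h i hi l hlB)
      rw [mem_below] at hl
      omega
    have := Finset.card_le_card h1
    rw [card_below σ (by omega)] at this
    omega
  · intro hi
    by_contra hiB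
    have h1 : B ⊆ below σ (σ i) := fun l hl => mem_below.2 (h l hl i hiB)
    have := Finset.card_le_card h1
    rw [card_below σ (by omega)] at this
    omega

/-! ### The faces of the affine complex and of its quotient -/

/-- Adding the indicator vector of the whole index set changes nothing modulo the constant vectors,
so every set of a flag may be taken proper. -/
theorem exists_weightPoint_below (a : Fin (d + 1) → ℤ) (σ : Equiv.Perm (Fin (d + 1)))
    {B : Finset (Fin (d + 1))} (h : ∀ i ∈ B, ∀ j ∉ B, σ i < σ j) :
    ∃ j : Fin (d + 1), weightPoint d (a + ind B) = weightPoint d (a + ind (below σ j)) := by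
  by_cases hB : B = Finset.univ
  · refine ⟨0, weightPoint_eq_iff.2 ⟨1, fun i => ?_⟩⟩
    subst hB
    simp [ind]
  · have h1 : B.card < d + 1 := by
      simpa using Finset.card_lt_card (Finset.ssubset_univ_iff.2 hB)
    refine ⟨⟨B.card, h1⟩, ?_⟩
    rw [← eq_below_card σ h]

/-- A face of the affine complex containing the point with integer coordinates `a` is contained in
the cell of `a` and the permutation that sorts the entries of `p - a` in decreasing order, where `p`
is an interior point of a region containing the face. -/
theorem exists_perm_of_mem_faces {F : Finset (weightLattice d)} (hF : F ∈ (affineComplex d).faces)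
    {a : Fin (d + 1) → ℤ} (ha : weightPoint d a ∈ F) :
    ∃ σ : Equiv.Perm (Fin (d + 1)), ∀ u ∈ F, ∃ j : Fin (d + 1),
      u = weightPoint d (a + ind (below σ j)) := by
  obtain ⟨-, p, hp, hFp⟩ := hF
  obtain ⟨σ, hσ⟩ := exists_perm_antitone fun i => p i - a i
  refine ⟨σ, fun u hu => ?_⟩
  obtain ⟨b, rfl⟩ := weightPoint_surjective u
  have hfl : ∀ i j, ⌊p j - p i⌋ ≤ a j - a i ∧ a j - a i ≤ ⌊p j - p i⌋ + 1 ∧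
      ⌊p j - p i⌋ ≤ b j - b i ∧ b j - b i ≤ ⌊p j - p i⌋ + 1 := by
    intro i j
    have h1 := (hFp _ ha).2 i j
    have h2 := (hFp _ hu).2 i j
    rw [weightPoint_sub] at h1 h2
    exact ⟨by exact_mod_cast h1.1, by exact_mod_cast h1.2, by exact_mod_cast h2.1,
      by exact_mod_cast h2.2⟩
  obtain ⟨i₀, hi₀⟩ := Finite.exists_min fun i => b i - a i
  set B : Finset (Fin (d + 1)) := Finset.univ.filter fun i => b i - a i ≠ b i₀ - a i₀ with hBdef
  have hB1 : ∀ i ∈ B, b i - a i = b i₀ - a i₀ + 1 := by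
    intro i hi
    rw [hBdef, Finset.mem_filter] at hi
    have := hi₀ i
    have := hfl i₀ i
    omega
  have hB0 : ∀ i ∉ B, b i - a i = b i₀ - a i₀ := by
    intro i hi
    rw [hBdef, Finset.mem_filter] at hi
    simpa using hi
  have hb : weightPoint d b = weightPoint d (a + ind B) := by
    refine weightPoint_eq_iff.2 ⟨b i₀ - a i₀, fun i => ?_⟩
    by_cases hi : i ∈ B
    · have := hB1 i hi
      simp only [Pi.add_apply, ind, hi, if_true]
      omega
    · have := hB0 i hi
      simp only [Pi.add_apply, ind, hi, if_false]
      omega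
  rw [hb]
  refine exists_weightPoint_below a σ fun i hi j hj => hσ i j ?_
  have h1 := hB1 i hi
  have h2 := hB0 j hj
  have h3 := hfl j i
  have hne : i ≠ j := fun h => hj (h ▸ hi)
  have h4 : a i - a j = ⌊p i - p j⌋ := by omega
  have h5 : (a i : ℝ) - a j ≤ p i - p j := by
    have := Int.floor_le (p i - p j)
    rw [← h4] at this
    exact_mod_cast this
  have h6 := hp.2 j i hne.symm (a i - a j)
  push_cast at h6
  have := lt_of_le_of_ne h5 (Ne.symm h6)
  linarith

/-- Conversely, every cell is a face of the affine complex: the point with coordinates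
`a - σ / (d + 1)`, moved into the hyperplane of coordinate sum `0`, is generic and its region has
the points of the cell as vertices. -/
theorem mem_faces_of_below {F : Finset (weightLattice d)} (hne : F.Nonempty)
    (a : Fin (d + 1) → ℤ) (σ : Equiv.Perm (Fin (d + 1)))
    (hF : ∀ u ∈ F, ∃ j : Fin (d + 1), u = weightPoint d (a + ind (below σ j))) :
    F ∈ (affineComplex d).faces := by
  have hd : (0 : ℝ) < (d : ℝ) + 1 := by positivity
  set q : Fin (d + 1) → ℝ := fun i => a i - (σ i : ℕ) / ((d : ℝ) + 1) with hq
  set c : ℝ := (∑ i, q i) / (d + 1)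
  have hdiff : ∀ i j, (q j - c) - (q i - c) =
      ((a j - a i : ℤ) : ℝ) + (((σ i : ℕ) : ℝ) - (σ j : ℕ)) / ((d : ℝ) + 1) := by
    intro i j
    simp only [hq]
    push_cast
    ring
  have hlt : ∀ i j, (((σ i : ℕ) : ℝ) - (σ j : ℕ)) / ((d : ℝ) + 1) < 1 := by
    intro i j
    rw [div_lt_one hd]
    have h1 : ((σ i : ℕ) : ℝ) < d + 1 := by exact_mod_cast (σ i).2
    have h2 : (0 : ℝ) ≤ ((σ j : ℕ) : ℝ) := by positivity
    linarith
  have hpos : ∀ i j, σ j < σ i → 0 < (((σ i : ℕ) : ℝ) - (σ j : ℕ)) / ((d : ℝ) + 1) := by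
    intro i j h
    have h1 : ((σ j : ℕ) : ℝ) < (σ i : ℕ) := by exact_mod_cast h
    exact div_pos (by linarith) hd
  have hswap : ∀ i j, (((σ i : ℕ) : ℝ) - (σ j : ℕ)) / ((d : ℝ) + 1) =
      - ((((σ j : ℕ) : ℝ) - (σ i : ℕ)) / ((d : ℝ) + 1)) := by
    intro i j
    rw [← neg_div]
    ring
  have hfl : ∀ i j, ⌊(q j - c) - (q i - c)⌋ = a j - a i + if σ i < σ j then -1 else 0 := by
    intro i j
    rw [hdiff, Int.floor_intCast_add]
    congr 1
    rw [Int.floor_eq_iff]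
    by_cases h : σ i < σ j
    · have h1 := hlt j i
      have h2 := hpos j i h
      rw [if_pos h, hswap]
      push_cast
      constructor <;> linarith
    · rw [if_neg h]
      rcases (not_lt.1 h).eq_or_lt with h1 | h1
      · rw [h1]; simp
      · have h2 := hlt i j
        have h3 := hpos i j h1
        push_cast
        constructor <;> linarith
  refine ⟨hne, fun i => q i - c, ⟨?_, ?_⟩, ?_⟩
  · simp only [Finset.sum_sub_distrib, Finset.sum_const, Finset.card_univ, Fintype.card_fin,
      nsmul_eq_mul, c]
    push_cast
    field_simp
    ring
  · intro i j hij m hm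
    have h1 := hfl i j
    rw [hm, Int.floor_intCast] at h1
    rw [hdiff, h1] at hm
    push_cast at hm
    have hne : σ i ≠ σ j := fun h => hij (σ.injective h)
    by_cases h : σ i < σ j
    · have h2 := hlt j i
      rw [if_pos h, hswap] at hm
      linarith
    · have h2 := hpos i j (lt_of_le_of_ne (not_lt.1 h) hne.symm)
      rw [if_neg h] at hm
      linarith
  · intro u hu
    obtain ⟨r, rfl⟩ := hF u hu
    refine ⟨(weightPoint d _).2.1, fun i j => ?_⟩
    rw [hfl, weightPoint_sub]
    norm_cast
    simp only [Pi.add_apply, ind, mem_below]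
    have h1 : σ i = σ j ∨ (σ i : ℕ) ≠ σ j := by
      rw [Ne, Fin.val_inj]; exact em _
    have h2 : σ i < σ j ↔ (σ i : ℕ) < σ j := Iff.rfl
    rcases h1 with h1 | h1
    · rw [h1]; simp
    · split_ifs <;> omega

open Classical in
/-- The cell of the torus complex given by an integer vector `a` and a map `g`, the classes of the
vertices `a + 1_B` where `B` runs through the sets `{g < j}`. If `g` is a permutation, this is the
image of the simplex obtained from `a` by adding the unit vectors one by one in the order `g`. -/
noncomputable def cell (k : Fin (d + 1) → ℕ) (a : Fin (d + 1) → ℤ) {m : ℕ}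
    (g : Fin (d + 1) → Fin m) : Finset (TorusVertex k) :=
  Finset.univ.image fun j : Fin m => torusPoint k (a + ind (below g j))

theorem mem_cell {k : Fin (d + 1) → ℕ} {a : Fin (d + 1) → ℤ} {m : ℕ} {g : Fin (d + 1) → Fin m}
    {v : TorusVertex k} :
    v ∈ cell k a g ↔ ∃ j : Fin m, torusPoint k (a + ind (below g j)) = v := by
  simp [cell]

theorem base_mem_cell (k : Fin (d + 1) → ℕ) (a : Fin (d + 1) → ℤ) {m : ℕ}
    (g : Fin (d + 1) → Fin m) : torusPoint k a ∈ cell k a g :=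
  mem_cell.2 ⟨⟨0, (g 0).pos⟩, by simp⟩

theorem torusPoint_below_inj (hd : 1 ≤ d) {k : Fin (d + 1) → ℕ} (hk : ∀ i, 0 < k i) {m : ℕ}
    {g g' : Fin (d + 1) → Fin m} (hg : Function.Surjective g) (hg' : Function.Surjective g')
    {a a' : Fin (d + 1) → ℤ} (ha : torusPoint k a = torusPoint k a') {j j' : Fin m}
    (h : torusPoint k (a + ind (below g j)) = torusPoint k (a' + ind (below g' j'))) :
    below g j = below g' j' := by
  rw [map_add, map_add, ha, add_right_inj] at h
  exact ind_injOn_torus hd hk (below_ne_univ hg j) (below_ne_univ hg' j') h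

theorem torusPoint_below_injective (hd : 1 ≤ d) {k : Fin (d + 1) → ℕ} (hk : ∀ i, 0 < k i) {m : ℕ}
    {g : Fin (d + 1) → Fin m} (hg : Function.Surjective g) (a : Fin (d + 1) → ℤ) :
    Function.Injective fun j : Fin m => torusPoint k (a + ind (below g j)) := fun _ _ h =>
  (below_strictMono hg).injective (torusPoint_below_inj hd hk hg hg rfl h)

theorem card_cell (hd : 1 ≤ d) {k : Fin (d + 1) → ℕ} (hk : ∀ i, 0 < k i) (a : Fin (d + 1) → ℤ)
    {m : ℕ} {g : Fin (d + 1) → Fin m} (hg : Function.Surjective g) : (cell k a g).card = m := by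
  classical
  rw [cell, Finset.card_image_of_injective _ (torusPoint_below_injective hd hk hg a)]
  simp

theorem cell_congr {k : Fin (d + 1) → ℕ} {a a' : Fin (d + 1) → ℤ}
    (h : torusPoint k a = torusPoint k a') {m : ℕ} (g : Fin (d + 1) → Fin m) :
    cell k a g = cell k a' g := by
  simp only [cell, map_add, h]

/-- A cell with a given base vertex determines the map that defines it. -/
theorem eq_of_cell_eq (hd : 1 ≤ d) {k : Fin (d + 1) → ℕ} (hk : ∀ i, 0 < k i)
    {a : Fin (d + 1) → ℤ} {m : ℕ} {g g' : Fin (d + 1) → Fin m} (hg : Function.Surjective g)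
    (hg' : Function.Surjective g') (h : cell k a g = cell k a g') : g = g' := by
  refine eq_of_below_eq hg fun j => ?_
  obtain ⟨j', hj'⟩ := mem_cell.1 (h ▸ mem_cell.2 ⟨j, rfl⟩ :
    torusPoint k (a + ind (below g j)) ∈ cell k a g')
  exact ⟨j', torusPoint_below_inj hd hk hg hg' rfl hj'.symm⟩

theorem mem_torusComplex_iff {k : Fin (d + 1) → ℕ} {s : Finset (TorusVertex k)} :
    s ∈ (torusComplex k).faces ↔
      s.Nonempty ∧ ∃ a, ∃ σ : Equiv.Perm (Fin (d + 1)), s ⊆ cell k a σ := by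
  classical
  constructor
  · rintro ⟨F, hF, rfl⟩
    obtain ⟨u, hu⟩ := hF.1
    obtain ⟨a, rfl⟩ := weightPoint_surjective u
    obtain ⟨σ, hσ⟩ := exists_perm_of_mem_faces hF hu
    refine ⟨by simpa using hF.1, a, σ, fun v hv => ?_⟩
    obtain ⟨u, hu, rfl⟩ := Finset.mem_image.1 hv
    obtain ⟨j, rfl⟩ := hσ u hu
    exact mem_cell.2 ⟨j, rfl⟩
  · rintro ⟨hs, a, σ, h⟩
    obtain ⟨J, -, rfl⟩ := Finset.subset_image_iff.1 h
    refine ⟨J.image fun j : Fin (d + 1) => weightPoint d (a + ind (below σ j)),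
      mem_faces_of_below (by simpa using hs) a σ ?_, ?_⟩
    · intro u hu
      obtain ⟨j, -, rfl⟩ := Finset.mem_image.1 hu
      exact ⟨j, rfl⟩
    · simp only [Finset.image_image, Function.comp_def, toTorus_weightPoint]

/-- A face of the torus complex may be put into a cell based at any of its vertices. -/
theorem exists_cell_of_mem {k : Fin (d + 1) → ℕ} {s : Finset (TorusVertex k)}
    (hs : s ∈ (torusComplex k).faces) {a : Fin (d + 1) → ℤ} (ha : torusPoint k a ∈ s) :
    ∃ σ : Equiv.Perm (Fin (d + 1)), s ⊆ cell k a σ := by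
  classical
  obtain ⟨F, hF, rfl⟩ := hs
  obtain ⟨u, hu, hua⟩ := Finset.mem_image.1 ha
  obtain ⟨b, rfl⟩ := weightPoint_surjective u
  obtain ⟨σ, hσ⟩ := exists_perm_of_mem_faces hF hu
  refine ⟨σ, fun v hv => ?_⟩
  obtain ⟨u, hu, rfl⟩ := Finset.mem_image.1 hv
  obtain ⟨j, rfl⟩ := hσ u hu
  rw [← cell_congr (show torusPoint k b = torusPoint k a from hua)]
  exact mem_cell.2 ⟨j, rfl⟩

theorem card_le_of_mem_torusComplex (hd : 1 ≤ d) {k : Fin (d + 1) → ℕ} (hk : ∀ i, 0 < k i)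
    {s : Finset (TorusVertex k)} (hs : s ∈ (torusComplex k).faces) : s.card ≤ d + 1 := by
  obtain ⟨-, a, σ, h⟩ := mem_torusComplex_iff.1 hs
  exact (Finset.card_le_card h).trans (card_cell hd hk a σ.surjective).le

theorem maximal_iff_cell (hd : 1 ≤ d) {k : Fin (d + 1) → ℕ} (hk : ∀ i, 0 < k i)
    {s : Finset (TorusVertex k)} :
    Maximal (fun t => t ∈ (torusComplex k).faces) s ↔
      ∃ a, ∃ σ : Equiv.Perm (Fin (d + 1)), s = cell k a σ := by
  have hcell : ∀ a, ∀ σ : Equiv.Perm (Fin (d + 1)), cell k a σ ∈ (torusComplex k).faces :=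
    fun a σ => mem_torusComplex_iff.2 ⟨⟨_, base_mem_cell k a σ⟩, a, σ, subset_rfl⟩
  constructor
  · rintro ⟨hs, hmax⟩
    obtain ⟨-, a, σ, h⟩ := mem_torusComplex_iff.1 hs
    exact ⟨a, σ, h.antisymm (hmax (hcell a σ) h)⟩
  · rintro ⟨a, σ, rfl⟩
    refine ⟨hcell a σ, fun t ht h => ?_⟩
    refine (Finset.eq_of_subset_of_card_le h ?_).ge
    rw [card_cell hd hk a σ.surjective]
    exact card_le_of_mem_torusComplex hd hk ht

theorem injOn_toTorus (hd : 1 ≤ d) {k : Fin (d + 1) → ℕ} (hk : ∀ i, 0 < k i)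
    {F : Finset (weightLattice d)} (hF : F ∈ (affineComplex d).faces) :
    Set.InjOn (toTorus k) (F : Set (weightLattice d)) := by
  intro u hu u' hu' h
  obtain ⟨a, rfl⟩ := weightPoint_surjective u
  obtain ⟨σ, hσ⟩ := exists_perm_of_mem_faces hF hu
  obtain ⟨j, hj⟩ := hσ _ hu
  obtain ⟨j', rfl⟩ := hσ _ hu'
  rw [hj, toTorus_weightPoint, toTorus_weightPoint] at h
  rw [hj, torusPoint_below_injective hd hk σ.surjective a h]

/-- If two faces have the same vertex classes, and `u`, `u'` are vertices of them in the same class,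
then the translation by `u' - u` carries the first face into the second. -/
theorem add_mem_of_image_subset (hd : 1 ≤ d) {k : Fin (d + 1) → ℕ} (hk : ∀ i, 0 < k i)
    {F G : Finset (weightLattice d)} (hF : F ∈ (affineComplex d).faces)
    (hG : G ∈ (affineComplex d).faces)
    (h : toTorus k '' (F : Set (weightLattice d)) ⊆ toTorus k '' (G : Set (weightLattice d)))
    {u u' : weightLattice d} (hu : u ∈ F) (hu' : u' ∈ G) (huu : toTorus k u = toTorus k u')
    {x : weightLattice d} (hx : x ∈ F) : x + (u' - u) ∈ G := by
  obtain ⟨a, rfl⟩ := weightPoint_surjective u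
  obtain ⟨b, rfl⟩ := weightPoint_surjective u'
  obtain ⟨σ, hσ⟩ := exists_perm_of_mem_faces hF hu
  obtain ⟨τ, hτ⟩ := exists_perm_of_mem_faces hG hu'
  obtain ⟨j, rfl⟩ := hσ _ hx
  obtain ⟨y, hy, hxy⟩ := h ⟨_, hx, rfl⟩
  obtain ⟨j', rfl⟩ := hτ _ hy
  have := torusPoint_below_inj hd hk σ.surjective τ.surjective huu hxy.symm
  rw [← this] at hy
  have heq : weightPoint d (a + ind (below σ j)) + (weightPoint d b - weightPoint d a) =
      weightPoint d (b + ind (below σ j)) := by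
    rw [← map_sub, ← map_add]
    congr 1
    abel
  rwa [heq]

theorem image_toTorus_eq_iff (hd : 1 ≤ d) {k : Fin (d + 1) → ℕ} (hk : ∀ i, 0 < k i)
    {F G : Finset (weightLattice d)} (hF : F ∈ (affineComplex d).faces)
    (hG : G ∈ (affineComplex d).faces) :
    toTorus k '' (F : Set (weightLattice d)) = toTorus k '' (G : Set (weightLattice d)) ↔
      FaceEquiv k F G := by
  constructor
  · intro h
    obtain ⟨u, hu⟩ := hF.1
    obtain ⟨u', hu', huu⟩ : toTorus k u ∈ toTorus k '' (G : Set (weightLattice d)) :=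
      h ▸ ⟨u, hu, rfl⟩
    have hmem : (u' - u).1 ∈ weightSublattice k := by
      have h1 := QuotientAddGroup.eq.1 huu.symm
      rw [AddSubgroup.mem_addSubgroupOf] at h1
      rwa [sub_eq_neg_add]
    refine ⟨_, hmem, ?_⟩
    ext x
    constructor
    · rintro ⟨y, hy, rfl⟩
      have := add_mem_of_image_subset hd hk hG hF h.ge hu' hu huu hy
      refine ⟨_, this, ?_⟩
      change (y + (u - u') + (u' - u)).1 = y.1
      congr 1
      abel
    · rintro ⟨y, hy, rfl⟩
      exact ⟨_, add_mem_of_image_subset hd hk hF hG h.le hu hu' huu.symm hy, rfl⟩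
  · rintro ⟨v, hv, h⟩
    have key : ∀ x y : weightLattice d, y.1 = x.1 + v → toTorus k y = toTorus k x := by
      intro x y hxy
      refine (QuotientAddGroup.eq.2 ?_).symm
      rw [AddSubgroup.mem_addSubgroupOf, AddSubgroup.coe_add, AddSubgroup.coe_neg, hxy]
      simpa using hv
    ext z
    constructor
    · rintro ⟨x, hx, rfl⟩
      obtain ⟨y, hy, hxy⟩ := h.ge ⟨x, hx, rfl⟩
      exact ⟨y, hy, key x y hxy⟩
    · rintro ⟨y, hy, rfl⟩
      obtain ⟨x, hx, hxy⟩ := h.le ⟨y, hy, rfl⟩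
      exact ⟨x, hx, (key x y hxy.symm).symm⟩

/-! ### Counting the faces -/

/-- Removing the first argument, a surjection onto `m + 1` elements either stays surjective or
becomes a surjection onto the complement of the removed value. -/
theorem card_surjective_succ (n m : ℕ) :
    Nat.card {g : Fin (n + 1) → Fin (m + 1) // Function.Surjective g} =
      (m + 1) * (Nat.card {g : Fin n → Fin (m + 1) // Function.Surjective g} +
        Nat.card {g : Fin n → Fin m // Function.Surjective g}) := by
  let e : Fin (m + 1) × ({g : Fin n → Fin (m + 1) // Function.Surjective g} ⊕
      {g : Fin n → Fin m // Function.Surjective g}) → (Fin (n + 1) → Fin (m + 1)) := fun p =>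
    Fin.cons p.1 (p.2.elim (fun f => f.1) fun f => p.1.succAbove ∘ f.1)
  have hsurj : ∀ p, Function.Surjective (e p) := by
    rintro ⟨x, f | f⟩ y
    · obtain ⟨l, rfl⟩ := f.2 y
      exact ⟨l.succ, by simp [e]⟩
    · by_cases hy : y = x
      · exact ⟨0, by simp [e, hy]⟩
      · obtain ⟨z, rfl⟩ := Fin.exists_succAbove_eq hy
        obtain ⟨l, rfl⟩ := f.2 z
        exact ⟨l.succ, by simp [e]⟩
  have hbij : Function.Bijective fun p => (⟨e p, hsurj p⟩ :
      {g : Fin (n + 1) → Fin (m + 1) // Function.Surjective g}) := by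
    constructor
    · rintro ⟨x, f⟩ ⟨x', f'⟩ h
      have h1 : e (x, f) = e (x', f') := congrArg Subtype.val h
      obtain ⟨rfl, h2⟩ := Fin.cons_injective2 h1
      rcases f with f | f <;> rcases f' with f' | f'
      · have h2 : f.1 = f'.1 := h2
        rw [Subtype.ext h2]
      · have h2 : f.1 = x.succAbove ∘ f'.1 := h2
        obtain ⟨l, hl⟩ := f.2 x
        rw [h2] at hl
        exact absurd hl (Fin.succAbove_ne x _)
      · have h2 : x.succAbove ∘ f.1 = f'.1 := h2
        obtain ⟨l, hl⟩ := f'.2 x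
        rw [← h2] at hl
        exact absurd hl (Fin.succAbove_ne x _)
      · have h2 : x.succAbove ∘ f.1 = x.succAbove ∘ f'.1 := h2
        rw [Subtype.ext ((Fin.succAbove_right_injective (p := x)).comp_left h2)]
    · rintro ⟨g, hg⟩
      by_cases ht : Function.Surjective (Fin.tail g)
      · exact ⟨(g 0, Sum.inl ⟨Fin.tail g, ht⟩), Subtype.ext (Fin.cons_self_tail g)⟩
      · have hne : ∀ l : Fin n, Fin.tail g l ≠ g 0 := by
          intro l hl
          refine ht fun y => ?_
          obtain ⟨l', rfl⟩ := hg y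
          induction l' using Fin.cases with
          | zero => exact ⟨l, hl⟩
          | succ l' => exact ⟨l', rfl⟩
        choose f hf using fun l => Fin.exists_succAbove_eq (hne l)
        have hfs : Function.Surjective f := by
          intro y
          obtain ⟨l, hl⟩ := hg ((g 0).succAbove y)
          induction l using Fin.cases with
          | zero => exact absurd hl.symm (Fin.succAbove_ne _ _)
          | succ l => exact ⟨l, Fin.succAbove_right_injective (by rw [hf, ← hl]; rfl)⟩
        refine ⟨(g 0, Sum.inr ⟨f, hfs⟩), Subtype.ext ?_⟩
        change Fin.cons (g 0) ((g 0).succAbove ∘ f) = g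
        rw [show (g 0).succAbove ∘ f = Fin.tail g from funext hf, Fin.cons_self_tail]
  rw [← Nat.card_congr (Equiv.ofBijective _ hbij), Nat.card_prod, Nat.card_sum]
  simp

theorem card_surjective (n m : ℕ) :
    Nat.card {g : Fin n → Fin m // Function.Surjective g} =
      m.factorial * Nat.stirlingSecond n m := by
  induction n generalizing m with
  | zero =>
    cases m with
    | zero =>
      have : Unique {g : Fin 0 → Fin 0 // Function.Surjective g} :=
        ⟨⟨⟨id, Function.surjective_id⟩⟩, fun g => Subtype.ext (Subsingleton.elim _ _)⟩
      simp
    | succ m =>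
      have : IsEmpty {g : Fin 0 → Fin (m + 1) // Function.Surjective g} :=
        ⟨fun g => (g.2 0).choose.elim0⟩
      simp
  | succ n ih =>
    cases m with
    | zero =>
      have : IsEmpty {g : Fin (n + 1) → Fin 0 // Function.Surjective g} := ⟨fun g => (g.1 0).elim0⟩
      simp
    | succ m =>
      rw [card_surjective_succ, ih, ih, Nat.stirlingSecond_succ_succ, Nat.factorial_succ]
      ring

/-- A flag is refined by a complete one, obtained by ordering the indices by their values; so its
cell is a face. -/
theorem cell_mem_faces (k : Fin (d + 1) → ℕ) (a : Fin (d + 1) → ℤ) {m : ℕ}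
    {g : Fin (d + 1) → Fin m} (hg : Function.Surjective g) :
    cell k a g ∈ (torusComplex k).faces := by
  obtain ⟨σ, hσ⟩ := exists_perm_antitone fun l => -((g l : ℕ) : ℝ)
  refine mem_torusComplex_iff.2 ⟨⟨_, base_mem_cell k a g⟩, a, σ, fun v hv => ?_⟩
  obtain ⟨j, rfl⟩ := mem_cell.1 hv
  have h1 : (below g j).card < d + 1 := by
    simpa using Finset.card_lt_card (Finset.ssubset_univ_iff.2 (below_ne_univ hg j))
  refine mem_cell.2 ⟨⟨_, h1⟩, ?_⟩
  rw [← eq_below_card σ]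
  intro i hi i' hi'
  refine hσ i i' ?_
  rw [mem_below] at hi hi'
  rw [neg_lt_neg_iff, Nat.cast_lt]
  omega

/-- Every face is a cell based at any of its vertices. If the face consists of the vertices of the
cell of a permutation `σ` at the positions in `J`, the corresponding surjection sends `l` to the
rank in `J` of the last position not exceeding `σ l`. -/
theorem exists_eq_cell (hd : 1 ≤ d) {k : Fin (d + 1) → ℕ} (hk : ∀ i, 0 < k i)
    {s : Finset (TorusVertex k)} (hs : s ∈ (torusComplex k).faces) {a : Fin (d + 1) → ℤ}
    (ha : torusPoint k a ∈ s) {m : ℕ} (hm : s.card = m) :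
    ∃ g : Fin (d + 1) → Fin m, Function.Surjective g ∧ s = cell k a g := by
  subst hm
  classical
  obtain ⟨σ, hσ⟩ := exists_cell_of_mem hs ha
  have hinj := torusPoint_below_injective hd hk σ.surjective a
  obtain ⟨J, -, hJ⟩ := Finset.subset_image_iff.1 (show s ⊆ Finset.univ.image fun j : Fin (d + 1) =>
    torusPoint k (a + ind (below σ j)) by rw [cell] at hσ; convert hσ)
  have hcard : J.card = s.card := by
    rw [← hJ, Finset.card_image_of_injective _ hinj]
  have h0 : (0 : Fin (d + 1)) ∈ J := by
    rw [← hJ] at ha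
    obtain ⟨j, hj, hj'⟩ := Finset.mem_image.1 ha
    have : j = 0 := hinj (hj'.trans (by simp))
    rwa [← this]
  let e := J.orderEmbOfFin hcard
  have he : ∀ j ∈ J, ∃ r, e r = j := by
    intro j hj
    have : j ∈ Set.range e := by rw [Finset.range_orderEmbOfFin]; exact hj
    exact this
  obtain ⟨r₀, hr₀⟩ := he 0 h0
  have hmax : ∀ l, ∃ r, e r ≤ σ l ∧ ∀ r', e r' ≤ σ l → r' ≤ r := by
    intro l
    obtain ⟨r, hr, hr'⟩ := Finset.exists_max_image (Finset.univ.filter fun r => e r ≤ σ l) id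
      ⟨r₀, by simp [hr₀]⟩
    exact ⟨r, by simpa using hr, fun r' h => hr' r' (by simpa using h)⟩
  choose g hg hg' using hmax
  have hiff : ∀ l r, r ≤ g l ↔ e r ≤ σ l := fun l r =>
    ⟨fun h => (e.monotone h).trans (hg l), hg' l r⟩
  have hbelow : ∀ r : Fin s.card, below g r = below σ (e r) := by
    intro r
    ext l
    rw [mem_below, mem_below, Fin.val_fin_lt, Fin.val_fin_lt, ← not_le, hiff, not_le]
  refine ⟨g, fun r => ⟨σ.symm (e r), ?_⟩, ?_⟩
  · refine le_antisymm ?_ ((hiff _ _).2 (by simp))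
    have := hg (σ.symm (e r))
    rw [Equiv.apply_symm_apply] at this
    exact e.le_iff_le.1 this
  · ext v
    conv_lhs => rw [← hJ]
    rw [Finset.mem_image, mem_cell]
    constructor
    · rintro ⟨j, hj, rfl⟩
      obtain ⟨r, rfl⟩ := he j hj
      exact ⟨r, by rw [hbelow]⟩
    · rintro ⟨r, rfl⟩
      exact ⟨e r, Finset.orderEmbOfFin_mem _ _ r, by rw [hbelow]⟩

/-- Counting the pairs of an `i`-dimensional face and a vertex of it in two ways. -/
theorem card_flags (hd : 1 ≤ d) {k : Fin (d + 1) → ℕ} (hk : ∀ i, 0 < k i) (i : ℕ) :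
    fVector (torusComplex k) i * (i + 1) =
      Nat.card (TorusVertex k) *
        Nat.card {g : Fin (d + 1) → Fin (i + 1) // Function.Surjective g} := by
  have : Finite (TorusVertex k) := finite_torusVertex hd hk
  have : Finite (Finset (TorusVertex k)) := by
    have := Fintype.ofFinite (TorusVertex k)
    infer_instance
  let b : TorusVertex k → (Fin (d + 1) → ℤ) := Function.surjInv (torusPoint_surjective k)
  have hb : ∀ v, torusPoint k (b v) = v := Function.surjInv_eq _
  let N := {s : Finset (TorusVertex k) // s ∈ (torusComplex k).faces ∧ s.card = i + 1}
  let e : TorusVertex k × {g : Fin (d + 1) → Fin (i + 1) // Function.Surjective g} →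
      (Σ s : N, s.1) := fun p =>
    ⟨⟨cell k (b p.1) p.2.1, cell_mem_faces k _ p.2.2, card_cell hd hk _ p.2.2⟩,
      ⟨p.1, by
        have := base_mem_cell k (b p.1) p.2.1
        rwa [hb] at this⟩⟩
  have hbij : Function.Bijective e := by
    constructor
    · rintro ⟨v, g⟩ ⟨v', g'⟩ h
      have h1 : v = v' := congrArg (fun x : (Σ s : N, s.1) => x.2.1) h
      subst h1
      have h2 : cell k (b v) g.1 = cell k (b v) g'.1 :=
        congrArg (fun x : (Σ s : N, s.1) => x.1.1) h
      rw [Subtype.ext (eq_of_cell_eq hd hk g.2 g'.2 h2)]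
    · rintro ⟨⟨s, hs, hc⟩, ⟨v, hv⟩⟩
      have hv' := hv
      change v ∈ s at hv'
      rw [← hb v] at hv'
      obtain ⟨g, hg, rfl⟩ := exists_eq_cell hd hk hs hv' hc
      exact ⟨(v, ⟨g, hg⟩), rfl⟩
  have h := Nat.card_congr (Equiv.ofBijective e hbij)
  have : Fintype N := Fintype.ofFinite N
  rw [Nat.card_prod, Nat.card_sigma] at h
  rw [h, Finset.sum_congr rfl (g := fun _ => i + 1)]
  · simp [fVector, N]
  · intro s _
    simp [s.2.2]

theorem fVector_eq (hd : 1 ≤ d) {k : Fin (d + 1) → ℕ} (hk : ∀ i, 0 < k i) (i : ℕ) :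
    (fVector (torusComplex k) i : ℤ) =
      (Nat.factorial i : ℤ) * (Nat.stirlingSecond (d + 1) (i + 1) : ℤ) * D k := by
  have h := card_flags hd hk i
  rw [card_surjective, Nat.factorial_succ] at h
  have h1 : ((i : ℤ) + 1) ≠ 0 := by positivity
  apply mul_right_cancel₀ h1
  rw [← card_torusVertex hd hk]
  have h2 := congrArg (Nat.cast : ℕ → ℤ) h
  push_cast at h2
  rw [h2]
  ring

theorem fVector_codim_one (hd : 1 ≤ d) {k : Fin (d + 1) → ℕ} (hk : ∀ i, 0 < k i) :
    (fVector (torusComplex k) (d - 1) : ℚ) = (Nat.factorial (d + 1) : ℚ) / 2 * (D k : ℚ) := by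
  obtain ⟨e, rfl⟩ : ∃ e, d = e + 1 := ⟨d - 1, by omega⟩
  have h := congrArg (Int.cast : ℤ → ℚ) (fVector_eq hd hk e)
  rw [Nat.stirlingSecond_succ_self_left] at h
  push_cast at h
  rw [Nat.cast_choose_two] at h
  rw [Nat.add_sub_cancel, h, Nat.factorial_succ, Nat.factorial_succ]
  push_cast
  ring

/-! ### The vertices of the tiling and the facets of the torus complex -/

theorem intComb_w_apply (a : Fin (d + 1) → ℤ) (i : Fin (d + 1)) :
    intComb (w d) a i = (d + 1) * a i - ∑ l, (a l : ℝ) := by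
  have h : ∀ l, a l • w d l i = (if l = i then ((d : ℝ) + 1) * a l else 0) - (a l : ℝ) := by
    intro l
    by_cases hl : l = i
    · subst hl
      simp [w, Pi.single_apply]
      ring
    · simp [w, Pi.single_apply, hl, Ne.symm hl]
  change (∑ l, a l • w d l) i = _
  rw [Finset.sum_apply]
  simp only [Pi.smul_apply, h, Finset.sum_sub_distrib]
  simp

/-- The vertex of the tiling that corresponds to the cell given by an integer vector and a
permutation. It is `d + 1` times the barycenter of that cell, up to a constant vector. -/
noncomputable def tilingPoint (b : Fin (d + 1) → ℤ) (g : Equiv.Perm (Fin (d + 1))) :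
    TilingVertex d :=
  ⟨(fun i => (((g.trans Fin.revPerm) i : ℕ) : ℝ) + 1) + intComb (w d) b,
    g.trans Fin.revPerm, _, ⟨b, rfl⟩, rfl⟩

theorem tilingPoint_apply (b : Fin (d + 1) → ℤ) (g : Equiv.Perm (Fin (d + 1))) (i : Fin (d + 1)) :
    (tilingPoint b g).1 i = (d + 1) * (b i + 1) - (g i : ℕ) - ∑ l, (b l : ℝ) := by
  have h : ((Fin.rev (g i) : ℕ) : ℝ) = d - (g i : ℕ) := by
    rw [Fin.val_rev, Nat.cast_sub (by omega)]
    push_cast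
    ring
  change ((Fin.rev (g i) : ℕ) : ℝ) + 1 + intComb (w d) b i = _
  rw [h, intComb_w_apply]
  ring

theorem tilingPoint_surjective (x : TilingVertex d) : ∃ b g, tilingPoint b g = x := by
  obtain ⟨x, σ, v, ⟨b, rfl⟩, rfl⟩ := x
  refine ⟨b, σ.trans Fin.revPerm, Subtype.ext ?_⟩
  ext i
  simp [tilingPoint]

theorem val_subRight (g : Equiv.Perm (Fin (d + 1))) (j l : Fin (d + 1)) :
    (((g.trans (Equiv.subRight j)) l : ℕ) : ℤ) = g l - j + (d + 1) * ind (below g j) l := by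
  change (((g l - j : Fin (d + 1)) : ℕ) : ℤ) = _
  simp only [ind, mem_below]
  split_ifs with h
  · rw [Fin.coe_sub_iff_lt.2 h]; omega
  · have := Fin.le_def.1 (not_lt.1 h : j ≤ g l)
    rw [Fin.sub_val_of_le (not_lt.1 h)]; omega

theorem sum_ind (B : Finset (Fin (d + 1))) : ∑ l, ind B l = B.card := by
  simp [ind]

/-- Moving the base vertex of a cell to another one of its vertices rotates the permutation
cyclically, and does not change the associated vertex of the tiling. -/
theorem tilingPoint_rebase (b : Fin (d + 1) → ℤ) (g : Equiv.Perm (Fin (d + 1)))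
    (j : Fin (d + 1)) :
    tilingPoint (b + ind (below g j)) (g.trans (Equiv.subRight j)) = tilingPoint b g := by
  refine Subtype.ext (funext fun l => ?_)
  have h1 := congrArg (Int.cast : ℤ → ℝ) (val_subRight g j l)
  have h2 := congrArg (Int.cast : ℤ → ℝ) (sum_ind (below g j))
  rw [card_below g j.2.le] at h2
  push_cast at h1 h2
  rw [tilingPoint_apply, tilingPoint_apply, h1]
  simp only [Pi.add_apply, Int.cast_add, Finset.sum_add_distrib, h2]
  ring

/-- The class of a vertex of the tiling in the generalized Heawood graph. -/
noncomputable def heawoodPoint (k : Fin (d + 1) → ℕ) (b : Fin (d + 1) → ℤ)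
    (g : Equiv.Perm (Fin (d + 1))) : HeawoodVertex k :=
  Quotient.mk _ (tilingPoint b g)

theorem heawoodPoint_surjective {k : Fin (d + 1) → ℕ} (x : HeawoodVertex k) :
    ∃ b g, heawoodPoint k b g = x := by
  induction x using Quotient.inductionOn with
  | h x =>
    obtain ⟨b, g, rfl⟩ := tilingPoint_surjective x
    exact ⟨b, g, rfl⟩

theorem heawoodPoint_eq_iff {k : Fin (d + 1) → ℕ} {b b' : Fin (d + 1) → ℤ}
    {g g' : Equiv.Perm (Fin (d + 1))} :
    heawoodPoint k b g = heawoodPoint k b' g' ↔ ∃ l ∈ rowLattice k, ∃ c : ℤ, ∀ i,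
      (d + 1) * b' i - (g' i : ℕ) = (d + 1) * (b i + l i) - (g i : ℕ) + c := by
  rw [heawoodPoint, heawoodPoint, Quotient.eq]
  constructor
  · rintro ⟨_, ⟨l, hl, rfl⟩, h⟩
    refine ⟨l, hl, ∑ i, b' i - ∑ i, b i - ∑ i, l i, fun i => ?_⟩
    have h1 := congrFun h i
    rw [Pi.add_apply, intComb_w_apply, tilingPoint_apply, tilingPoint_apply] at h1
    have h2 : (((d + 1) * b' i - (g' i : ℕ) : ℤ) : ℝ) = (((d + 1) * (b i + l i) - (g i : ℕ) +
        (∑ i, b' i - ∑ i, b i - ∑ i, l i) : ℤ) : ℝ) := by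
      push_cast
      linarith
    exact_mod_cast h2
  · rintro ⟨l, hl, c, h⟩
    have hsum : ∀ σ : Equiv.Perm (Fin (d + 1)), ∑ i, ((σ i : ℕ) : ℤ) = ∑ i : Fin (d + 1), (i : ℤ) :=
      fun σ => Equiv.sum_comp σ fun i => ((i : ℕ) : ℤ)
    have hc : c = ∑ i, b' i - ∑ i, b i - ∑ i, l i := by
      have h1 := Finset.sum_congr (rfl : Finset.univ = Finset.univ) fun i _ => h i
      simp only [Finset.sum_sub_distrib, Finset.sum_add_distrib, ← Finset.mul_sum, hsum,
        Finset.sum_const, Finset.card_univ, Fintype.card_fin, nsmul_eq_mul] at h1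
      have hd : (d : ℤ) + 1 ≠ 0 := by positivity
      apply mul_left_cancel₀ hd
      push_cast at h1
      linarith
    refine ⟨_, ⟨l, hl, rfl⟩, funext fun i => ?_⟩
    change (tilingPoint b' g').1 i = (tilingPoint b g).1 i + intComb (w d) l i
    rw [intComb_w_apply, tilingPoint_apply, tilingPoint_apply]
    have h1 := congrArg (Int.cast : ℤ → ℝ) (h i)
    rw [hc] at h1
    push_cast at h1
    linarith

/-- The vertices of a cell are the classes of the roundings of the points on a line in direction
`(1, …, 1)`. This description does not refer to a base vertex. -/
theorem mem_cell_iff_ediv (hd : 1 ≤ d) {k : Fin (d + 1) → ℕ} {b : Fin (d + 1) → ℤ}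
    {g : Equiv.Perm (Fin (d + 1))} {v : TorusVertex k} :
    v ∈ cell k b g ↔
      ∃ s : ℤ, torusPoint k (fun l => ((d + 1) * b l - 1 - (g l : ℕ) + s) / (d + 1)) = v := by
  have hn : (0 : ℤ) < d + 1 := by positivity
  have key : ∀ (q : ℤ) (j : Fin (d + 1)),
      torusPoint k (fun l => ((d + 1) * b l - 1 - (g l : ℕ) + ((d + 1) * q + (j : ℕ))) / (d + 1)) =
      torusPoint k (b + ind (below g j)) := by
    intro q j
    have h1 : (fun l => ((d + 1) * b l - 1 - (g l : ℕ) + ((d + 1) * q + (j : ℕ))) / ((d : ℤ) + 1)) =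
        (b + ind (below g j)) + fun _ => q - 1 := by
      ext l
      have h2 := (g l).2
      have h3 := j.2
      have h4 : ((d + 1) * b l - 1 - (g l : ℕ) + ((d + 1) * q + (j : ℕ)) : ℤ) =
          ((j : ℕ) - 1 - (g l : ℕ) + (d + 1)) + (d + 1) * (b l + q - 1) := by ring
      rw [h4, Int.add_mul_ediv_left _ _ hn.ne']
      simp only [Pi.add_apply, ind, mem_below]
      split_ifs with h
      · have : ((j : ℕ) - 1 - (g l : ℕ) + (d + 1) : ℤ) / (d + 1) = 1 := by
          rw [Int.ediv_eq_iff_of_pos hn]; constructor <;> omega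
        rw [this]; ring
      · have : ((j : ℕ) - 1 - (g l : ℕ) + (d + 1) : ℤ) / (d + 1) = 0 := by
          apply Int.ediv_eq_zero_of_lt <;> omega
        rw [this]; ring
    rw [h1, map_add, torusPoint_const hd, add_zero]
  rw [mem_cell]
  constructor
  · rintro ⟨j, rfl⟩
    exact ⟨_, key 0 j⟩
  · rintro ⟨s, rfl⟩
    have h1 := Int.emod_nonneg s hn.ne'
    have h2 := Int.emod_lt_of_pos s hn
    refine ⟨⟨(s % (d + 1)).toNat, by omega⟩, ?_⟩
    rw [← key (s / (d + 1))]
    have h3 : ((s % (d + 1)).toNat : ℤ) = s % (d + 1) := Int.toNat_of_nonneg h1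
    simp only [h3, Int.mul_ediv_add_emod]

theorem cell_eq_of_heawoodPoint_eq (hd : 1 ≤ d) {k : Fin (d + 1) → ℕ} {b b' : Fin (d + 1) → ℤ}
    {g g' : Equiv.Perm (Fin (d + 1))} (h : heawoodPoint k b g = heawoodPoint k b' g') :
    cell k b g = cell k b' g' := by
  have key : ∀ {b b' : Fin (d + 1) → ℤ} {g g' : Equiv.Perm (Fin (d + 1))},
      heawoodPoint k b g = heawoodPoint k b' g' → cell k b' g' ⊆ cell k b g := by
    intro b b' g g' h v hv
    obtain ⟨l, hl, c, h⟩ := heawoodPoint_eq_iff.1 h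
    obtain ⟨s, rfl⟩ := (mem_cell_iff_ediv hd).1 hv
    refine (mem_cell_iff_ediv hd).2 ⟨s + c, ?_⟩
    have h1 : (fun i => ((d + 1) * b' i - 1 - (g' i : ℕ) + s) / ((d : ℤ) + 1)) =
        (fun i => ((d + 1) * b i - 1 - (g i : ℕ) + (s + c)) / ((d : ℤ) + 1)) + l := by
      ext i
      have h2 : ((d + 1) * b' i - 1 - (g' i : ℕ) + s : ℤ) =
          ((d + 1) * b i - 1 - (g i : ℕ) + (s + c)) + (d + 1) * l i := by linarith [h i]
      rw [h2, Int.add_mul_ediv_left _ _ (by positivity)]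
      rfl
    rw [h1, map_add, (torusPoint_eq_zero_iff hd).2 hl, add_zero]
  exact (key h.symm).antisymm (key h)

theorem heawoodPoint_rebase (k : Fin (d + 1) → ℕ) (b : Fin (d + 1) → ℤ)
    (g : Equiv.Perm (Fin (d + 1))) (j : Fin (d + 1)) :
    heawoodPoint k (b + ind (below g j)) (g.trans (Equiv.subRight j)) = heawoodPoint k b g := by
  rw [heawoodPoint, tilingPoint_rebase, heawoodPoint]

/-- After a change of base vertex, two equal cells have the same base vertex, and then they have the
same permutation. -/
theorem cell_eq_iff (hd : 1 ≤ d) {k : Fin (d + 1) → ℕ} (hk : ∀ i, 0 < k i)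
    {b b' : Fin (d + 1) → ℤ} {g g' : Equiv.Perm (Fin (d + 1))} :
    cell k b g = cell k b' g' ↔ heawoodPoint k b g = heawoodPoint k b' g' := by
  refine ⟨fun h => ?_, cell_eq_of_heawoodPoint_eq hd⟩
  obtain ⟨j, hj⟩ := mem_cell.1 (h ▸ base_mem_cell k b' g' : torusPoint k b' ∈ cell k b g)
  rw [← heawoodPoint_rebase k b g j] at *
  rw [← cell_eq_of_heawoodPoint_eq hd (heawoodPoint_rebase k b g j), cell_congr hj] at h
  have hg := DFunLike.coe_injective (eq_of_cell_eq hd hk (Equiv.surjective _) g'.surjective h)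
  rw [hg]
  refine heawoodPoint_eq_iff.2 ⟨_, (torusPoint_eq_iff hd).1 hj.symm, 0, fun i => ?_⟩
  simp only [Pi.sub_apply, Pi.add_apply]
  ring

/-- The bijection between the vertices of the generalized Heawood graph and the facets of the torus
complex. -/
theorem exists_vertexEquiv (hd : 1 ≤ d) {k : Fin (d + 1) → ℕ} (hk : ∀ i, 0 < k i) :
    ∃ φ : HeawoodVertex k ≃ Facet (torusComplex k),
      ∀ b g, (φ (heawoodPoint k b g)).1 = cell k b g := by
  choose b g hbg using heawoodPoint_surjective (k := k)
  let f : HeawoodVertex k → Facet (torusComplex k) := fun x =>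
    ⟨cell k (b x) (g x), (maximal_iff_cell hd hk).2 ⟨_, _, rfl⟩⟩
  have hf : ∀ b' g', (f (heawoodPoint k b' g')).1 = cell k b' g' := fun b' g' =>
    (cell_eq_iff hd hk).2 (hbg _)
  have hbij : Function.Bijective f := by
    constructor
    · intro x y h
      have h1 : cell k (b x) (g x) = cell k (b y) (g y) := congrArg Subtype.val h
      rw [← hbg x, ← hbg y]
      exact (cell_eq_iff hd hk).1 h1
    · rintro ⟨s, hs⟩
      obtain ⟨a, σ, rfl⟩ := (maximal_iff_cell hd hk).1 hs
      exact ⟨heawoodPoint k a σ, Subtype.ext (hf a σ)⟩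
  exact ⟨Equiv.ofBijective f hbij, hf⟩

/-! ### The edges of the tiling and the dual graph -/

theorem val_one_of_le (hd : 1 ≤ d) : ((1 : Fin (d + 1)) : ℕ) = 1 := by
  rw [Fin.val_one', Nat.mod_eq_of_lt (by omega)]

theorem tilingPoint_swap_sub (hd : 1 ≤ d) (b : Fin (d + 1) → ℤ) {g : Equiv.Perm (Fin (d + 1))}
    {i j : Fin (d + 1)} (hi : g i = 0) (hj : g j = 1) :
    (tilingPoint b ((Equiv.swap i j).trans g)).1 - (tilingPoint b g).1 =
      Pi.single j 1 - Pi.single i 1 := by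
  have h1 := val_one_of_le hd
  have hij : i ≠ j := by
    rintro rfl
    rw [hi] at hj
    rw [← hj] at h1
    simp at h1
  ext l
  simp only [Pi.sub_apply, tilingPoint_apply, Equiv.trans_apply]
  by_cases hli : l = i
  · subst hli
    rw [Equiv.swap_apply_left, hi, hj, h1]
    simp [hij]
  · by_cases hlj : l = j
    · subst hlj
      rw [Equiv.swap_apply_right, hi, hj, h1]
      simp [hij.symm]
    · rw [Equiv.swap_apply_of_ne_of_ne hli hlj]
      simp [hli, hlj]

/-- Up to a change of the base vertex, adjacent vertices of the tiling are given by permutations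
that differ by exchanging the indices with the values `0` and `1`. -/
theorem exists_swap_of_adj (hd : 1 ≤ d) {x y : TilingVertex d} (h : (tilingGraph d).Adj x y) :
    ∃ b g i j, g i = 0 ∧ g j = 1 ∧ x = tilingPoint b g ∧
      y = tilingPoint b ((Equiv.swap i j).trans g) := by
  obtain ⟨i, j, hij, h⟩ := h
  obtain ⟨b₀, g₀, rfl⟩ := tilingPoint_surjective x
  obtain ⟨b', g', rfl⟩ := tilingPoint_surjective y
  rw [← tilingPoint_rebase b₀ g₀ (g₀ i)] at h ⊢
  set g := g₀.trans (Equiv.subRight (g₀ i)) with hg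
  set b := b₀ + ind (below g₀ (g₀ i))
  have hi : g i = 0 := by simp [hg]
  have hn := val_one_of_le hd
  have hE : ∀ l, ((d : ℤ) + 1) * (b' l - b l) + (g l : ℕ) - (g' l : ℕ) - (∑ i, b' i - ∑ i, b i) =
      (if l = j then 1 else 0) - (if l = i then 1 else 0) := by
    intro l
    have h1 := congrFun h l
    simp only [Pi.sub_apply, tilingPoint_apply, Pi.single_apply] at h1
    have h2 : ((((d : ℤ) + 1) * (b' l - b l) + (g l : ℕ) - (g' l : ℕ) -
        (∑ i, b' i - ∑ i, b i) : ℤ) : ℝ) =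
        (((if l = j then 1 else 0) - (if l = i then 1 else 0) : ℤ) : ℝ) := by
      push_cast
      rw [← h1]
      ring
    exact_mod_cast h2
  have hj : g j = 1 := by
    by_contra hj
    set l := g.symm 1 with hl
    have hgl : g l = 1 := by simp [hl]
    have hli : l ≠ i := by
      intro h1
      rw [h1, hi] at hgl
      rw [← hgl] at hn
      simp at hn
    have hlj : l ≠ j := fun h1 => hj (h1 ▸ hgl)
    have e1 := hE i
    have e2 := hE l
    rw [hi, if_neg hij, if_pos rfl] at e1
    rw [hgl, hn, if_neg hli, if_neg hlj] at e2
    -- Both `g' i` and `g' l` have the residue `1 - ∑ b' + ∑ b` modulo `d + 1`.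
    have e3 : ((d : ℤ) + 1) * ((b' i - b i) - (b' l - b l)) = (g' i : ℕ) - (g' l : ℕ) := by
      simp only [Fin.val_zero] at e1
      push_cast at e1 e2
      linarith
    have b1 := (g' i).2
    have b2 := (g' l).2
    have e4 : (b' i - b i) - (b' l - b l) = 0 := by
      by_contra h0
      rcases lt_or_gt_of_ne h0 with h0 | h0
      · nlinarith
      · nlinarith
    rw [e4] at e3
    exact hli (g'.injective (Fin.ext (by omega)))
  refine ⟨b, g, i, j, hi, hj, rfl, Subtype.ext ?_⟩
  have h2 := tilingPoint_swap_sub hd b hi hj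
  rw [← h] at h2
  exact (sub_left_injective h2).symm

theorem adj_swap (hd : 1 ≤ d) (b : Fin (d + 1) → ℤ) {g : Equiv.Perm (Fin (d + 1))}
    {i j : Fin (d + 1)} (hi : g i = 0) (hj : g j = 1) :
    (tilingGraph d).Adj (tilingPoint b g) (tilingPoint b ((Equiv.swap i j).trans g)) := by
  refine ⟨i, j, ?_, tilingPoint_swap_sub hd b hi hj⟩
  rintro rfl
  have h1 := val_one_of_le hd
  rw [← hj, hi] at h1
  simp at h1

/-- The flags of two permutations that differ by exchanging the indices with the values `0` and `1`
differ only in the set of size one. -/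
theorem below_swap (hd : 1 ≤ d) {g : Equiv.Perm (Fin (d + 1))} {i j : Fin (d + 1)} (hi : g i = 0)
    (hj : g j = 1) {s : ℕ} (hs : s ≠ 1) : below ((Equiv.swap i j).trans g) s = below g s := by
  have h1 := val_one_of_le hd
  ext l
  rw [mem_below, mem_below, Equiv.trans_apply]
  by_cases hli : l = i
  · subst hli
    rw [Equiv.swap_apply_left, hi, hj, h1]
    simp
    omega
  · by_cases hlj : l = j
    · subst hlj
      rw [Equiv.swap_apply_right, hi, hj, h1]
      simp
      omega
    · rw [Equiv.swap_apply_of_ne_of_ne hli hlj]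

/-- The ends of an edge of the tiling become different facets that share a face of codimension one,
obtained by removing the vertex in position `1`. -/
theorem cell_swap (hd : 1 ≤ d) {k : Fin (d + 1) → ℕ} (hk : ∀ i, 0 < k i) (b : Fin (d + 1) → ℤ)
    {g : Equiv.Perm (Fin (d + 1))} {i j : Fin (d + 1)} (hi : g i = 0) (hj : g j = 1) :
    cell k b g ≠ cell k b ((Equiv.swap i j).trans g) ∧ ∃ r ∈ (torusComplex k).faces,
      r ⊆ cell k b g ∧ r ⊆ cell k b ((Equiv.swap i j).trans g) ∧ r.card + 1 = d + 1 := by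
  classical
  have h1 := val_one_of_le hd
  have h01 : (0 : Fin (d + 1)) ≠ 1 := by
    intro h
    rw [← h] at h1
    simp at h1
  constructor
  · intro h
    have h2 := congrFun (eq_of_cell_eq hd hk g.surjective (Equiv.surjective _) h) i
    rw [Equiv.trans_apply, Equiv.swap_apply_left, hi, hj] at h2
    exact h01 h2
  · have hinj := torusPoint_below_injective hd hk g.surjective b
    have hmem : torusPoint k (b + ind (below g (1 : Fin (d + 1)))) ∈ cell k b g :=
      mem_cell.2 ⟨1, rfl⟩
    refine ⟨(cell k b g).erase (torusPoint k (b + ind (below g (1 : Fin (d + 1))))),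
      mem_torusComplex_iff.2 ⟨⟨torusPoint k b, ?_⟩, b, g, Finset.erase_subset _ _⟩,
      Finset.erase_subset _ _, ?_, ?_⟩
    · refine Finset.mem_erase.2 ⟨fun h => h01 (hinj (Eq.trans ?_ h)), base_mem_cell k b g⟩
      simp
    · intro v hv
      obtain ⟨hne, hv⟩ := Finset.mem_erase.1 hv
      obtain ⟨s, rfl⟩ := mem_cell.1 hv
      have hs : (s : ℕ) ≠ 1 := by
        intro h
        rw [h, h1] at hne
        exact hne rfl
      exact mem_cell.2 ⟨s, by rw [below_swap hd hi hj hs]⟩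
    · rw [Finset.card_erase_of_mem hmem, card_cell hd hk b g.surjective]
      omega

/-- Two permutations whose flags agree in all sets of size different from one are equal or differ by
exchanging the indices with the values `0` and `1`. -/
theorem eq_or_eq_swap (hd : 2 ≤ d) {g g' : Equiv.Perm (Fin (d + 1))} {i j : Fin (d + 1)}
    (hi : g i = 0) (hj : g j = 1) (h : ∀ s : Fin (d + 1), s ≠ 1 → below g s = below g' s) :
    g' = g ∨ g' = (Equiv.swap i j).trans g := by
  have h1 := val_one_of_le (d := d) (by omega)
  have hlt : ∀ l, ∀ s : ℕ, s ≠ 1 → ((g l : ℕ) < s ↔ (g' l : ℕ) < s) := by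
    intro l s hs
    by_cases hs' : s < d + 1
    · have h2 := h ⟨s, hs'⟩ (fun h => hs (by rw [← h1, ← h]))
      rw [← mem_below, ← mem_below (g := g')]
      exact iff_of_eq (congrArg (l ∈ ·) h2)
    · constructor <;> intro <;> omega
  have hge : ∀ l, 2 ≤ (g l : ℕ) → g' l = g l := by
    intro l hl
    have h2 := hlt l (g l) (by omega)
    have h3 := hlt l (g l + 1) (by omega)
    exact Fin.ext (by omega)
  have hother : ∀ l, l ≠ i → l ≠ j → g' l = g l := by
    intro l hli hlj
    refine hge l ?_
    by_contra hl
    have h2 : (g l : ℕ) ≠ 0 := fun h2 => hli (g.injective (Fin.ext (by rw [hi, h2]; simp)))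
    have h3 : (g l : ℕ) ≠ 1 := fun h2 => hlj (g.injective (Fin.ext (by rw [hj, h2, h1])))
    omega
  have hij : i ≠ j := by
    rintro rfl
    rw [← hj, hi] at h1
    simp at h1
  have hi2 := hlt i 2 (by omega)
  have hj2 := hlt j 2 (by omega)
  rw [hi] at hi2
  rw [hj, h1] at hj2
  simp only [Fin.val_zero] at hi2
  have hne : (g' i : ℕ) ≠ g' j := fun h => hij (g'.injective (Fin.ext h))
  by_cases h0 : (g' i : ℕ) = 0
  · left
    ext l
    by_cases hli : l = i
    · rw [hli, hi, h0]; simp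
    · by_cases hlj : l = j
      · rw [hlj, hj, h1]; omega
      · rw [hother l hli hlj]
  · right
    ext l
    rw [Equiv.trans_apply]
    by_cases hli : l = i
    · rw [hli, Equiv.swap_apply_left, hj, h1]; omega
    · by_cases hlj : l = j
      · rw [hlj, Equiv.swap_apply_right, hi, Fin.val_zero]; omega
      · rw [Equiv.swap_apply_of_ne_of_ne hli hlj, hother l hli hlj]

/-- A facet may be written as a cell in which a given vertex is in position `1`: move the base
vertex to the given vertex, and then one step back in the cyclic order. -/
theorem exists_cell_position_one (hd : 1 ≤ d) {k : Fin (d + 1) → ℕ} {b₀ : Fin (d + 1) → ℤ}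
    {g₀ : Equiv.Perm (Fin (d + 1))} {v : TorusVertex k} (hv : v ∈ cell k b₀ g₀) :
    ∃ b, ∃ g : Equiv.Perm (Fin (d + 1)), cell k b g = cell k b₀ g₀ ∧
      torusPoint k (b + ind (below g 1)) = v := by
  obtain ⟨j, rfl⟩ := mem_cell.1 hv
  rw [← cell_eq_of_heawoodPoint_eq hd (heawoodPoint_rebase k b₀ g₀ j)]
  set g₁ := g₀.trans (Equiv.subRight j)
  set b₁ := b₀ + ind (below g₀ j)
  refine ⟨b₁ + ind (below g₁ (Fin.last d)), g₁.trans (Equiv.subRight (Fin.last d)),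
    cell_eq_of_heawoodPoint_eq hd (heawoodPoint_rebase k b₁ g₁ (Fin.last d)), ?_⟩
  have : b₁ + ind (below g₁ (Fin.last d)) +
      ind (below (g₁.trans (Equiv.subRight (Fin.last d))) 1) = b₁ + fun _ => 1 := by
    rw [add_assoc]
    congr 1
    ext l
    have h := val_subRight g₁ (Fin.last d) l
    have h2 := (g₁ l).2
    simp only [Pi.add_apply, ind, mem_below, Fin.val_last] at h ⊢
    split_ifs at h ⊢ <;> omega
  rw [this, map_add, torusPoint_const hd, add_zero]

/-- Adjacent facets of the torus complex come from adjacent vertices of the tiling. -/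
theorem exists_swap_of_dual_adj (hd : 2 ≤ d) {k : Fin (d + 1) → ℕ} (hk : ∀ i, 0 < k i)
    {F G r : Finset (TorusVertex k)} (hF : Maximal (fun t => t ∈ (torusComplex k).faces) F)
    (hG : Maximal (fun t => t ∈ (torusComplex k).faces) G) (hFG : F ≠ G) (hrF : r ⊆ F) (hrG : r ⊆ G)
    (hcard : r.card + 1 = F.card) :
    ∃ (b : _) (g : Equiv.Perm (Fin (d + 1))) (i j : _), g i = 0 ∧ g j = 1 ∧
      cell k b g = F ∧ cell k b ((Equiv.swap i j).trans g) = G := by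
  classical
  have hd' : 1 ≤ d := by omega
  have h1 := val_one_of_le hd'
  obtain ⟨v, hv⟩ : ∃ v, F \ r = {v} := by
    rw [← Finset.card_eq_one, Finset.card_sdiff_of_subset hrF]
    omega
  have hr : ∀ u ∈ F, u ≠ v → u ∈ r := by
    intro u hu huv
    by_contra hur
    exact huv (Finset.mem_singleton.1 (hv ▸ Finset.mem_sdiff.2 ⟨hu, hur⟩))
  obtain ⟨b₀, g₀, rfl⟩ := (maximal_iff_cell hd' hk).1 hF
  have hvF : v ∈ cell k b₀ g₀ :=
    (Finset.mem_sdiff.1 (hv.symm ▸ Finset.mem_singleton_self v : v ∈ cell k b₀ g₀ \ r)).1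
  obtain ⟨b, g, hbg, rfl⟩ := exists_cell_position_one hd' hvF
  rw [← hbg] at hF hFG hr ⊢
  have hmem : ∀ s : Fin (d + 1), s ≠ 1 → torusPoint k (b + ind (below g s)) ∈ r := by
    intro s hs
    refine hr _ (mem_cell.2 ⟨s, rfl⟩) fun h => hs ?_
    refine torusPoint_below_injective hd' hk g.surjective b (Eq.trans h ?_)
    simp only [h1]
  have hbG : torusPoint k b ∈ G := by
    refine hrG ?_
    have := hmem 0 (by
      intro h
      rw [← h] at h1
      simp at h1)
    simpa using this
  obtain ⟨g', hg'⟩ := exists_cell_of_mem hG.1 hbG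
  have hGg : G = cell k b g' := hg'.antisymm (hG.2 (cell_mem_faces k b g'.surjective) hg')
  have hbelow : ∀ s : Fin (d + 1), s ≠ 1 → below g s = below g' s := by
    intro s hs
    obtain ⟨s', hs'⟩ := mem_cell.1 (hGg ▸ hrG (hmem s hs) :
      torusPoint k (b + ind (below g s)) ∈ cell k b g')
    have h2 := torusPoint_below_inj hd' hk g'.surjective g.surjective rfl hs'
    have h3 := congrArg Finset.card h2
    rw [card_below g' s'.2.le, card_below g s.2.le] at h3
    rw [← h2, h3]
  refine ⟨b, g, g.symm 0, g.symm 1, by simp, by simp, rfl, ?_⟩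
  rcases eq_or_eq_swap (i := g.symm 0) (j := g.symm 1) hd (by simp) (by simp) hbelow with h | h
  · rw [hGg, h] at hFG
    exact absurd rfl hFG
  · rw [hGg, h]

theorem abs_single_sub_single_le (i j l : Fin (d + 1)) :
    |(Pi.single j 1 - Pi.single i 1 : Fin (d + 1) → ℝ) l| ≤ 1 := by
  rw [Pi.sub_apply, Pi.single_apply, Pi.single_apply]
  split_ifs <;> norm_num

/-- Two edges whose ends are equivalent are translates of each other by one and the same vector: the
two translations differ by a vector of the sublattice with entries of absolute value at most `2`,
and `0` is the only such vector as `d + 1 ≥ 3`. -/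
theorem exists_translation_of_adj (hd : 2 ≤ d) {k : Fin (d + 1) → ℕ} (hk : ∀ i, 0 < k i)
    {x y x' y' : TilingVertex d} (h : (tilingGraph d).Adj x y) (h' : (tilingGraph d).Adj x' y')
    (hx : (vertexSetoid k) x x') (hy : (vertexSetoid k) y y') :
    ∃ v ∈ tilingSublattice k, x'.1 = x.1 + v ∧ y'.1 = y.1 + v := by
  obtain ⟨_, ⟨l₁, hl₁, rfl⟩, hx⟩ := hx
  obtain ⟨_, ⟨l₂, hl₂, rfl⟩, hy⟩ := hy
  obtain ⟨i, j, -, h⟩ := h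
  obtain ⟨i', j', -, h'⟩ := h'
  refine ⟨_, ⟨l₁, hl₁, rfl⟩, hx, ?_⟩
  rw [hy]
  congr 1
  have hl : l₂ - l₁ ∈ rowLattice k := sub_mem hl₂ hl₁
  have hdiff : intComb (w d) (l₂ - l₁) = (y'.1 - x'.1) - (y.1 - x.1) := by
    rw [map_sub, hx, hy]
    abel
  rw [h, h'] at hdiff
  have hbound : ∀ p, |intComb (w d) (l₂ - l₁) p| ≤ 2 := by
    intro p
    rw [hdiff]
    refine (abs_sub _ _).trans ?_
    linarith [abs_single_sub_single_le i j p, abs_single_sub_single_le i' j' p]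
  set m := l₂ - l₁
  have hm : ∀ p q, |m p - m q| ≤ 1 := by
    intro p q
    have h1 := abs_le.1 (hbound p)
    have h2 := abs_le.1 (hbound q)
    rw [intComb_w_apply] at h1 h2
    have h3 : ((d : ℤ) + 1) * (m p - m q) ≤ 4 := by
      have : ((d : ℝ) + 1) * (m p - m q) ≤ 4 := by linarith
      exact_mod_cast this
    have h4 : -4 ≤ ((d : ℤ) + 1) * (m p - m q) := by
      have : -4 ≤ ((d : ℝ) + 1) * (m p - m q) := by linarith
      exact_mod_cast this
    have h5 : (2 : ℤ) ≤ d := by exact_mod_cast hd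
    rw [abs_le]
    constructor <;> nlinarith
  have hconst : ∀ p, m p = m 0 := by
    intro p
    have h1 : m - (fun _ => m 0) ∈ rowLattice k :=
      sub_mem hl (const_mem_rowLattice (by omega) k (m 0))
    have := const_of_mem_rowLattice (by omega) hk h1 (fun q => hm q 0) p 0
    simpa [sub_eq_zero] using this
  have h0 : intComb (w d) m = 0 := by
    ext p
    rw [intComb_w_apply]
    simp only [hconst]
    simp
  rw [map_sub, sub_eq_zero] at h0
  exact h0

theorem heawoodEnds_mk (k : Fin (d + 1) → ℕ) {x y : TilingVertex d}
    (h : (tilingGraph d).Adj x y) :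
    heawoodEnds k (Quotient.mk _ ⟨s(x, y), h⟩) =
      s(Quotient.mk (vertexSetoid k) x, Quotient.mk (vertexSetoid k) y) := rfl

theorem heawoodEnds_injective (hd : 2 ≤ d) {k : Fin (d + 1) → ℕ} (hk : ∀ i, 0 < k i) :
    Function.Injective (heawoodEnds k) := by
  intro e f
  induction e using Quotient.inductionOn with | h e
  induction f using Quotient.inductionOn with | h f
  obtain ⟨e, he⟩ := e
  obtain ⟨f, hf⟩ := f
  induction e using Sym2.ind with | _ x y
  induction f using Sym2.ind with | _ x' y'
  intro h
  rw [heawoodEnds_mk k he, heawoodEnds_mk k hf, Sym2.eq_iff] at h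
  have he : (tilingGraph d).Adj x y := he
  have hf : (tilingGraph d).Adj x' y' := hf
  apply Quotient.sound
  rcases h with ⟨h1, h2⟩ | ⟨h1, h2⟩
  · obtain ⟨v, hv, hx, hy⟩ := exists_translation_of_adj hd hk he hf (Quotient.exact h1)
      (Quotient.exact h2)
    refine ⟨v, hv, ?_⟩
    change s(x'.1, y'.1) = s(x.1 + v, y.1 + v)
    rw [hx, hy]
  · obtain ⟨v, hv, hx, hy⟩ := exists_translation_of_adj hd hk he hf.symm (Quotient.exact h1)
      (Quotient.exact h2)
    refine ⟨v, hv, ?_⟩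
    change s(x'.1, y'.1) = s(x.1 + v, y.1 + v)
    rw [hx, hy, Sym2.eq_swap]

/-- The generalized Heawood graph is isomorphic to the dual graph of the torus complex. -/
theorem exists_heawood_iso_dual (hd : 2 ≤ d) {k : Fin (d + 1) → ℕ} (hk : ∀ i, 0 < k i) :
    ∃ (φ : HeawoodVertex k ≃ Facet (torusComplex k))
      (ψ : HeawoodEdge k ≃ (dualGraph (torusComplex k)).edgeSet),
      ∀ e x y, (heawoodGraph k).IsLink e x y ↔ (ψ e : Sym2 _) = s(φ x, φ y) := by
  have hd' : 1 ≤ d := by omega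
  obtain ⟨φ, hφ⟩ := exists_vertexEquiv hd' hk
  have hmem : ∀ e, (heawoodEnds k e).map φ ∈ (dualGraph (torusComplex k)).edgeSet := by
    intro e
    induction e using Quotient.inductionOn with | h e
    obtain ⟨e, he⟩ := e
    induction e using Sym2.ind with | _ x y
    obtain ⟨b, g, i, j, hi, hj, rfl, rfl⟩ := exists_swap_of_adj hd' he
    rw [heawoodEnds_mk k he, Sym2.map_mk, SimpleGraph.mem_edgeSet]
    have h1 := hφ b g
    have h2 := hφ b ((Equiv.swap i j).trans g)
    obtain ⟨hne, r, hr, hr1, hr2, hc⟩ := cell_swap hd' hk b hi hj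
    refine ⟨fun h => hne ?_, r, hr, ?_, ?_, ?_, ?_⟩
    · rw [← h1, ← h2]
      exact congrArg Subtype.val h
    · exact h1.symm ▸ hr1
    · exact h2.symm ▸ hr2
    · refine hc.trans ?_
      exact (card_cell hd' hk b g.surjective).symm.trans (congrArg Finset.card h1.symm)
    · refine hc.trans ?_
      exact (card_cell hd' hk b (Equiv.surjective _)).symm.trans (congrArg Finset.card h2.symm)
  have hbij : Function.Bijective fun e => (⟨_, hmem e⟩ : (dualGraph (torusComplex k)).edgeSet) := by
    constructor
    · intro e f h
      exact heawoodEnds_injective hd hk (Sym2.map.injective φ.injective (congrArg Subtype.val h))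
    · rintro ⟨e, he⟩
      induction e using Sym2.ind with | _ F G
      obtain ⟨hne, r, -, hrF, hrG, hc, -⟩ := (SimpleGraph.mem_edgeSet _).1 he
      obtain ⟨b, g, i, j, hi, hj, hF, hG⟩ := exists_swap_of_dual_adj hd hk F.2 G.2
        (fun h => hne (Subtype.ext h)) hrF hrG hc
      refine ⟨Quotient.mk (edgeSetoid k) ⟨s(_, _), adj_swap hd' b hi hj⟩, Subtype.ext ?_⟩
      refine (congrArg (Sym2.map φ) (heawoodEnds_mk k (adj_swap hd' b hi hj))).trans ?_
      rw [Sym2.map_mk]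
      have h1 : φ (heawoodPoint k b g) = F := Subtype.ext ((hφ b g).trans hF)
      have h2 : φ (heawoodPoint k b ((Equiv.swap i j).trans g)) = G :=
        Subtype.ext ((hφ b _).trans hG)
      exact congrArg₂ (fun F G => s(F, G)) h1 h2
  refine ⟨φ, Equiv.ofBijective _ hbij, fun e x y => ?_⟩
  change heawoodEnds k e = s(x, y) ↔ Sym2.map φ (heawoodEnds k e) = s(φ x, φ y)
  rw [← Sym2.map_mk, (Sym2.map.injective φ.injective).eq_iff]

open MeasureTheory Filter Topology

/-! ### Barycentric coordinates as integrals -/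

/-- The integer vector obtained by rounding down the vector `x + t (1, …, 1)`. -/
noncomputable def floorShift (x : Fin (d + 1) → ℝ) (t : ℝ) : Fin (d + 1) → ℤ := fun l => ⌊x l + t⌋

open Classical in
/-- The coordinate at `v` of the point of the realization of the torus complex that belongs to `x`:
the measure of the set of those `t` in the unit interval for which `x + t (1, …, 1)`, rounded down,
lies in the class `v`. -/
noncomputable def baryWeight (k : Fin (d + 1) → ℕ) (x : Fin (d + 1) → ℝ) (v : TorusVertex k) : ℝ :=
  ∫ t in (0 : ℝ)..1, if torusPoint k (floorShift x t) = v then (1 : ℝ) else 0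

theorem measurable_comp_floorShift {α : Type*} [MeasurableSpace α]
    (f : (Fin (d + 1) → ℤ) → α) (x : Fin (d + 1) → ℝ) :
    Measurable fun t => f (floorShift x t) := by
  have h1 : Measurable f := measurable_of_countable f
  refine h1.comp (measurable_pi_lambda _ fun l => ?_)
  exact Int.measurable_floor.comp (measurable_const.add measurable_id)

theorem intervalIntegrable_of_bdd {f : ℝ → ℝ} (hf : Measurable f) {C : ℝ} (hC : ∀ t, |f t| ≤ C)
    (p q : ℝ) : IntervalIntegrable f volume p q :=
  (intervalIntegrable_const (c := C)).mono_fun hf.aestronglyMeasurable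
    (Eventually.of_forall fun t => by
      simpa using (hC t).trans (le_abs_self C))

open Classical in
theorem intervalIntegrable_indicator (k : Fin (d + 1) → ℕ) (x : Fin (d + 1) → ℝ)
    (v : TorusVertex k) (p q : ℝ) : IntervalIntegrable
      (fun t => if torusPoint k (floorShift x t) = v then (1 : ℝ) else 0) volume p q :=
  intervalIntegrable_of_bdd
    (measurable_comp_floorShift (fun a => if torusPoint k a = v then (1 : ℝ) else 0) x) (C := 1)
    (fun t => by split_ifs <;> simp) p q

theorem baryWeight_nonneg (k : Fin (d + 1) → ℕ) (x : Fin (d + 1) → ℝ) (v : TorusVertex k) :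
    0 ≤ baryWeight k x v :=
  intervalIntegral.integral_nonneg zero_le_one fun t _ => by split_ifs <;> simp

theorem le_baryWeight {k : Fin (d + 1) → ℕ} {x : Fin (d + 1) → ℝ} {v : TorusVertex k} {p q : ℝ}
    (hp : 0 ≤ p) (hpq : p ≤ q) (hq : q ≤ 1)
    (h : ∀ t, p ≤ t → t < q → torusPoint k (floorShift x t) = v) : q - p ≤ baryWeight k x v := by
  classical
  have h1 : ∫ t in p..q, (if torusPoint k (floorShift x t) = v then (1 : ℝ) else 0) = q - p := by
    rw [intervalIntegral.integral_congr_ae (g := fun _ => (1 : ℝ))]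
    · simp
    · have : ({q}ᶜ : Set ℝ) ∈ ae volume := compl_mem_ae_iff.2 (by simp)
      filter_upwards [this] with t ht hmem
      rw [Set.uIoc_of_le hpq] at hmem
      rw [if_pos (h t hmem.1.le (lt_of_le_of_ne hmem.2 ht))]
  rw [← h1]
  refine (intervalIntegral.integral_mono_interval hp hpq hq (Eventually.of_forall fun t => ?_)
    (intervalIntegrable_indicator k x v 0 1)).trans (le_of_eq ?_)
  · simp only [Pi.zero_apply]
    split_ifs <;> simp
  · unfold baryWeight
    congr!

theorem baryWeight_eq_zero {k : Fin (d + 1) → ℕ} {x : Fin (d + 1) → ℝ} {v : TorusVertex k}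
    (h : ∀ t, 0 ≤ t → t ≤ 1 → torusPoint k (floorShift x t) ≠ v) : baryWeight k x v = 0 := by
  unfold baryWeight
  rw [intervalIntegral.integral_congr (g := fun _ => (0 : ℝ))]
  · simp
  · intro t ht
    rw [Set.uIcc_of_le zero_le_one] at ht
    exact if_neg (h t ht.1 ht.2)

/-- The weighted average of a function on the vertices is an integral over the unit interval. -/
theorem sum_baryWeight_mul {k : Fin (d + 1) → ℕ} [Fintype (TorusVertex k)] (x : Fin (d + 1) → ℝ)
    (H : TorusVertex k → ℝ) :
    ∑ v, baryWeight k x v * H v = ∫ t in (0 : ℝ)..1, H (torusPoint k (floorShift x t)) := by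
  classical
  simp only [baryWeight, ← intervalIntegral.integral_mul_const]
  rw [← intervalIntegral.integral_finsetSum
    fun v _ => (intervalIntegrable_indicator k x v 0 1).mul_const (H v)]
  congr 1
  ext t
  simp

theorem sum_baryWeight {k : Fin (d + 1) → ℕ} [Fintype (TorusVertex k)] (x : Fin (d + 1) → ℝ) :
    ∑ v, baryWeight k x v = 1 := by
  have := sum_baryWeight_mul (k := k) x fun _ => 1
  simpa using this

theorem eventually_floor_eq {y : ℝ} (hy : ∀ m : ℤ, y ≠ m) : ∀ᶠ z in 𝓝 y, ⌊z⌋ = ⌊y⌋ := by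
  have h1 : (⌊y⌋ : ℝ) < y := lt_of_le_of_ne (Int.floor_le y) (hy _).symm
  filter_upwards [Ioo_mem_nhds h1 (Int.lt_floor_add_one y)] with z hz
  exact Int.floor_eq_iff.2 ⟨hz.1.le, hz.2⟩

/-- For almost all `t`, rounding down is locally constant at `x + t (1, …, 1)`, so the coordinates
depend continuously on `x` by dominated convergence. -/
theorem continuous_baryWeight (k : Fin (d + 1) → ℕ) (v : TorusVertex k) :
    Continuous fun x => baryWeight k x v := by
  classical
  refine continuous_iff_continuousAt.2 fun x₀ => ?_
  refine intervalIntegral.continuousAt_of_dominated_interval (bound := fun _ => 1) ?_ ?_ ?_ ?_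
  · exact Eventually.of_forall fun x => (measurable_comp_floorShift
      (fun a => if torusPoint k a = v then (1 : ℝ) else 0) x).aestronglyMeasurable
  · refine Eventually.of_forall fun x => Eventually.of_forall fun t _ => ?_
    split_ifs <;> simp
  · exact intervalIntegrable_const
  · have hc : (⋃ l : Fin (d + 1), ⋃ m : ℤ, {(m : ℝ) - x₀ l}).Countable :=
      Set.countable_iUnion fun l => Set.countable_iUnion fun m => Set.countable_singleton _
    filter_upwards [compl_mem_ae_iff.2 (hc.measure_zero volume)] with t ht _
    have hfloor : ∀ᶠ x in 𝓝 x₀, floorShift x t = floorShift x₀ t := by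
      have : ∀ l, ∀ᶠ x : Fin (d + 1) → ℝ in 𝓝 x₀, ⌊x l + t⌋ = ⌊x₀ l + t⌋ := by
        intro l
        have hcont : ContinuousAt (fun x : Fin (d + 1) → ℝ => x l + t) x₀ :=
          ((continuous_apply l).add continuous_const).continuousAt
        refine hcont.eventually (eventually_floor_eq fun m hm => ht ?_)
        simp only [Set.mem_iUnion, Set.mem_singleton_iff]
        exact ⟨l, m, by linarith⟩
      filter_upwards [eventually_all.2 this] with x hx
      exact funext hx
    refine ContinuousAt.congr
      (f := fun _ => if torusPoint k (floorShift x₀ t) = v then (1 : ℝ) else 0)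
      continuousAt_const ?_
    filter_upwards [hfloor] with x hx
    rw [hx]

theorem baryWeight_add_const (hd : 1 ≤ d) (k : Fin (d + 1) → ℕ) (x : Fin (d + 1) → ℝ) (c : ℝ) :
    baryWeight k (x + fun _ => c) = baryWeight k x := by
  ext v
  classical
  set f : ℝ → ℝ := fun t => if torusPoint k (floorShift x t) = v then (1 : ℝ) else 0
  have hper : Function.Periodic f 1 := by
    intro t
    have : floorShift x (t + 1) = floorShift x t + fun _ => 1 := by
      ext l
      simp [floorShift, ← add_assoc]
    simp only [f, this, map_add, torusPoint_const hd, add_zero]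
  have h1 : baryWeight k (x + fun _ => c) v = ∫ t in (0 : ℝ)..1, f (c + t) := by
    unfold baryWeight
    have h2 : ∀ t, floorShift (x + fun _ => c) t = floorShift x (c + t) := fun t => by
      ext l
      simp [floorShift, add_assoc]
    simp only [h2, f]
  rw [h1, intervalIntegral.integral_comp_add_left, add_zero, hper.intervalIntegral_add_eq c 0,
    zero_add]
  unfold baryWeight
  congr!

theorem floorShift_add_int (x : Fin (d + 1) → ℝ) (a : Fin (d + 1) → ℤ) (t : ℝ) :
    floorShift (x + fun l => (a l : ℝ)) t = floorShift x t + a := by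
  ext l
  simp only [floorShift, Pi.add_apply]
  rw [add_right_comm, Int.floor_add_intCast]

theorem baryWeight_add_rowLattice (hd : 1 ≤ d) {k : Fin (d + 1) → ℕ} (x : Fin (d + 1) → ℝ)
    {a : Fin (d + 1) → ℤ} (ha : a ∈ rowLattice k) :
    baryWeight k (x + fun l => (a l : ℝ)) = baryWeight k x := by
  ext v
  have h : ∀ t, torusPoint k (floorShift (x + fun l => (a l : ℝ)) t) =
      torusPoint k (floorShift x t) := fun t => by
    rw [floorShift_add_int, map_add, (torusPoint_eq_zero_iff hd).2 ha, add_zero]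
  unfold baryWeight
  congr! 4 with t
  exact h t

/-- For `t` in the unit interval, rounding down `x + t (1, …, 1)` adds to the rounding of `x` the
indicator vector of the indices where the fractional part of `x` is large. -/
theorem floorShift_eq_ind (x : Fin (d + 1) → ℝ) {t : ℝ} (h0 : 0 ≤ t) (h1 : t ≤ 1) :
    floorShift x t = floorShift x 0 +
      ind (Finset.univ.filter fun l => 1 ≤ Int.fract (x l) + t) := by
  ext l
  simp only [floorShift, Pi.add_apply, ind, Finset.mem_filter, Finset.mem_univ, true_and, add_zero]
  have h2 := Int.fract_nonneg (x l)
  have h3 := Int.fract_lt_one (x l)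
  have h4 := Int.floor_add_fract (x l)
  rw [Int.floor_eq_iff]
  split_ifs with h <;> push_cast <;> constructor <;> linarith

theorem baryWeight_mem_realization (hd : 1 ≤ d) {k : Fin (d + 1) → ℕ} (hk : ∀ i, 0 < k i)
    (x : Fin (d + 1) → ℝ) : baryWeight k x ∈ realization (torusComplex k) := by
  have := finite_torusVertex hd hk
  have := Fintype.ofFinite (TorusVertex k)
  obtain ⟨σ, hσ⟩ := exists_perm_antitone fun l => Int.fract (x l)
  have hsupp : ∀ v, v ∉ cell k (floorShift x 0) σ → baryWeight k x v = 0 := by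
    intro v hv
    refine baryWeight_eq_zero fun t h0 h1 h => hv ?_
    rw [floorShift_eq_ind x h0 h1] at h
    obtain ⟨j, hj⟩ := exists_weightPoint_below (floorShift x 0) σ
      (B := Finset.univ.filter fun l => 1 ≤ Int.fract (x l) + t) (fun i hi j hj => hσ i j (by
        simp only [Finset.mem_filter, Finset.mem_univ, true_and] at hi hj
        linarith))
    exact mem_cell.2 ⟨j, (congrArg (toTorus k) hj).symm.trans h⟩
  refine ⟨baryWeight_nonneg k x, _, cell_mem_faces k (floorShift x 0) σ.surjective, hsupp, ?_⟩
  rw [← sum_baryWeight (k := k) x]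
  exact Finset.sum_subset (Finset.subset_univ _) fun v _ hv => hsupp v hv

/-! ### Fibres and image of the barycentric coordinates -/

theorem integral_floor_add (y : ℝ) : ∫ t in (0 : ℝ)..1, (⌊y + t⌋ : ℝ) = y := by
  have hint : ∀ p q, IntervalIntegrable (fun t : ℝ => Int.fract (y + t)) volume p q := fun p q =>
    intervalIntegrable_of_bdd (measurable_fract.comp (measurable_const.add measurable_id)) (C := 1)
      (fun t => by
        change |Int.fract (y + t)| ≤ 1
        rw [Int.abs_fract]
        exact (Int.fract_lt_one _).le) p q
  have h1 : ∫ t in (0 : ℝ)..1, Int.fract (y + t) = 1 / 2 := by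
    rw [intervalIntegral.integral_comp_add_left (fun t => Int.fract t), add_zero,
      Function.Periodic.intervalIntegral_add_eq (f := fun t : ℝ => Int.fract t)
        (Int.fract_periodic ℝ) y 0, zero_add]
    rw [intervalIntegral.integral_congr_ae (g := fun t => t)]
    · simp
    · have : ({1}ᶜ : Set ℝ) ∈ ae volume := compl_mem_ae_iff.2 (by simp)
      filter_upwards [this] with t ht hmem
      rw [Set.uIoc_of_le zero_le_one] at hmem
      exact Int.fract_eq_self.2 ⟨hmem.1.le, lt_of_le_of_ne hmem.2 ht⟩
  have h2 : (fun t : ℝ => (⌊y + t⌋ : ℝ)) = fun t => (y + t) - Int.fract (y + t) := by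
    ext t
    rw [Int.self_sub_fract]
  rw [h2, intervalIntegral.integral_sub (by apply Continuous.intervalIntegrable; fun_prop)
    (hint 0 1), h1, intervalIntegral.integral_add (by simp) (by simp)]
  simp

/-- The difference of two entries of an indicator vector depends only on the class on the torus of a
fixed vector plus the indicator vector. -/
theorem exists_entry_diff (hd : 1 ≤ d) {k : Fin (d + 1) → ℕ} (hk : ∀ i, 0 < k i)
    (a : Fin (d + 1) → ℤ) (l m : Fin (d + 1)) :
    ∃ H : TorusVertex k → ℝ, ∀ B, H (torusPoint k (a + ind B)) = ind B l - ind B m := by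
  classical
  let H : TorusVertex k → ℝ := fun v =>
    if h : ∃ B : Finset (Fin (d + 1)), B ≠ Finset.univ ∧ torusPoint k (a + ind B) = v then
      ind h.choose l - ind h.choose m else 0
  have key : ∀ B, B ≠ Finset.univ → H (torusPoint k (a + ind B)) = ind B l - ind B m := by
    intro B hB
    have h : ∃ B' : Finset (Fin (d + 1)), B' ≠ Finset.univ ∧
        torusPoint k (a + ind B') = torusPoint k (a + ind B) := ⟨B, hB, rfl⟩
    have h1 : h.choose = B := by
      refine ind_injOn_torus hd hk h.choose_spec.1 hB ?_
      exact add_left_cancel ((map_add _ _ _).symm.trans (h.choose_spec.2.trans (map_add _ _ _)))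
    simp only [H]
    rw [dif_pos h, h1]
  refine ⟨H, fun B => ?_⟩
  by_cases hB : B = Finset.univ
  · have h1 : torusPoint k (a + ind B) = torusPoint k (a + ind ∅) := by
      have : ind B = fun _ => 1 := by
        ext i; simp [ind, hB]
      rw [this, map_add, torusPoint_const hd]
      simp
    rw [h1, key ∅ (Finset.univ_nonempty.ne_empty).symm]
    simp [ind, hB]
  · exact key B hB

/-- A point is determined by its coordinates up to translation by the row lattice and by constant
vectors. After such translations both points have the same integer parts; then each difference of
two entries is a weighted average of differences of entries of the vertices. -/
theorem exists_of_baryWeight_eq (hd : 1 ≤ d) {k : Fin (d + 1) → ℕ} (hk : ∀ i, 0 < k i)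
    {x y : Fin (d + 1) → ℝ} (h : baryWeight k x = baryWeight k y) :
    ∃ a ∈ rowLattice k, ∃ c : ℝ, ∀ l, x l = y l + a l + c := by
  have := finite_torusVertex hd hk
  have := Fintype.ofFinite (TorusVertex k)
  -- The class of the rounding of `y` has positive weight.
  have hpos : 0 < baryWeight k y (torusPoint k (floorShift y 0)) := by
    obtain ⟨l₀, hl₀⟩ := Finite.exists_max fun l => Int.fract (y l)
    have h1 := Int.fract_lt_one (y l₀)
    have h2 := Int.fract_nonneg (y l₀)
    refine lt_of_lt_of_le (show 0 < (1 - Int.fract (y l₀)) - 0 by linarith)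
      (le_baryWeight le_rfl (by linarith) (by linarith) fun t ht ht' => ?_)
    congr 1
    rw [floorShift_eq_ind y ht (by linarith)]
    convert add_zero _
    rw [← ind_empty]
    congr 1
    refine Finset.filter_eq_empty_iff.2 fun l _ => ?_
    have := hl₀ l
    simp only [not_le]
    linarith
  obtain ⟨t, ht⟩ : ∃ t, torusPoint k (floorShift x t) = torusPoint k (floorShift y 0) := by
    by_contra! hne
    rw [← h, baryWeight_eq_zero fun t _ _ => hne t] at hpos
    exact lt_irrefl _ hpos
  set a := floorShift x t - floorShift y 0 with ha
  have ha' : a ∈ rowLattice k := (torusPoint_eq_iff hd).1 ht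
  set x' : Fin (d + 1) → ℝ := x + fun _ => t with hx'
  set y' : Fin (d + 1) → ℝ := y + fun l => (a l : ℝ) with hy'
  have hw : baryWeight k x' = baryWeight k y' := by
    rw [hx', hy', baryWeight_add_const hd, baryWeight_add_rowLattice hd _ ha', h]
  have hx0 : floorShift x' 0 = floorShift x t := by
    ext l; simp [floorShift, hx']
  have hy0 : floorShift y' 0 = floorShift x t := by
    rw [hy', floorShift_add_int, ha]
    abel
  have hdiff : ∀ l, x' l - x' 0 = y' l - y' 0 := by
    intro l
    obtain ⟨H, hH⟩ := exists_entry_diff hd hk (floorShift x t) l 0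
    have key : ∀ z : Fin (d + 1) → ℝ, floorShift z 0 = floorShift x t →
        z l - z 0 = ∑ v, baryWeight k z v * H v + (floorShift x t l - floorShift x t 0) := by
      intro z hz
      have hint : ∀ p : Fin (d + 1), IntervalIntegrable (fun t => (⌊z p + t⌋ : ℝ)) volume 0 1 := by
        intro p
        refine (Monotone.intervalIntegrable fun s s' hs => ?_)
        have := Int.floor_mono (show z p + s ≤ z p + s' by linarith)
        exact_mod_cast this
      rw [sum_baryWeight_mul]
      have h1 : ∫ s in (0 : ℝ)..1, H (torusPoint k (floorShift z s)) =
          ∫ s in (0 : ℝ)..1, ((⌊z l + s⌋ : ℝ) - ⌊z 0 + s⌋ -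
            (floorShift x t l - floorShift x t 0 : ℝ)) := by
        refine intervalIntegral.integral_congr fun s hs => ?_
        rw [Set.uIcc_of_le zero_le_one] at hs
        have h2 := floorShift_eq_ind z hs.1 hs.2
        have h3 : ∀ p, (⌊z p + s⌋ : ℝ) = floorShift x t p +
            ind (Finset.univ.filter fun l => 1 ≤ Int.fract (z l) + s) p := by
          intro p
          have := congrFun h2 p
          rw [hz] at this
          exact_mod_cast this
        rw [h2, hz, hH, h3, h3]
        ring
      rw [h1, intervalIntegral.integral_sub ((hint l).sub (hint 0)) (by simp),
        intervalIntegral.integral_sub (hint l) (hint 0), integral_floor_add, integral_floor_add]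
      simp
    rw [key x' hx0, key y' hy0, hw]
  refine ⟨a, ha', x 0 - y 0 - a 0, fun l => ?_⟩
  have := hdiff l
  simp only [hx', hy', Pi.add_apply] at this
  linarith

/-- The point with given coordinates `c_j` at the vertices of a cell is found by adding up
the coordinates: its entry at `l` exceeds that of the base vertex by the sum of the coordinates of
the vertices obtained after adding the unit vector `e_l`. -/
theorem exists_baryWeight_eq (hd : 1 ≤ d) {k : Fin (d + 1) → ℕ} (hk : ∀ i, 0 < k i)
    {z : TorusVertex k → ℝ} (hz : z ∈ realization (torusComplex k)) :
    ∃ x, baryWeight k x = z := by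
  have := finite_torusVertex hd hk
  have := Fintype.ofFinite (TorusVertex k)
  classical
  obtain ⟨hz0, s, hs, hsupp, hsum⟩ := hz
  obtain ⟨-, a, σ, hsσ⟩ := mem_torusComplex_iff.1 hs
  have hinj := torusPoint_below_injective hd hk σ.surjective a
  have hsum' : ∑ v ∈ cell k a σ, z v = 1 := by
    rw [← hsum]
    exact (Finset.sum_subset hsσ fun v _ hv => hsupp v hv).symm
  set c : Fin (d + 1) → ℝ := fun j => z (torusPoint k (a + ind (below σ j))) with hc
  have hc0 : ∀ j, 0 ≤ c j := fun j => hz0 _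
  have hc1 : ∑ j, c j = 1 := by
    rw [← hsum', cell, Finset.sum_image fun i _ j _ h => hinj h]
  set C : ℕ → ℝ := fun m => ∑ j ∈ Finset.univ.filter fun j : Fin (d + 1) => (j : ℕ) < m, c j
    with hC
  have hCmono : Monotone C := fun m m' h => Finset.sum_le_sum_of_subset_of_nonneg
    (fun j hj => by
      simp only [Finset.mem_filter, Finset.mem_univ, true_and] at hj ⊢
      omega) fun j _ _ => hc0 j
  have hC0 : C 0 = 0 := by simp [hC]
  have hC1 : C (d + 1) = 1 := by
    rw [← hc1, hC]
    simp only
    rw [Finset.filter_true_of_mem fun j _ => j.2]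
  have hCs : ∀ j : Fin (d + 1), C (j + 1) = C j + c j := by
    intro j
    simp only [hC]
    have : (Finset.univ.filter fun i : Fin (d + 1) => (i : ℕ) < j + 1) =
        insert j (Finset.univ.filter fun i : Fin (d + 1) => (i : ℕ) < j) := by
      ext i
      simp only [Finset.mem_filter, Finset.mem_univ, true_and, Finset.mem_insert, Fin.ext_iff]
      omega
    rw [this, Finset.sum_insert (by simp), add_comm]
  set x : Fin (d + 1) → ℝ := fun l => a l + (1 - C (σ l + 1)) with hx
  have hle : ∀ v, z v ≤ baryWeight k x v := by
    intro v
    by_cases hv : v ∈ cell k a σ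
    · obtain ⟨j, rfl⟩ := mem_cell.1 hv
      have h1 : z (torusPoint k (a + ind (below σ j))) = C (j + 1) - C j := by
        rw [hCs]; simp [hc]
      rw [h1]
      have hj1 : C (j + 1) ≤ 1 := hC1 ▸ hCmono (by omega)
      refine le_baryWeight (hC0 ▸ hCmono (Nat.zero_le _)) (hCmono (by omega)) hj1
        fun t ht ht' => ?_
      congr 1
      ext l
      simp only [floorShift, hx, Pi.add_apply, ind, mem_below]
      rw [Int.floor_eq_iff]
      have h2 : 0 ≤ C (σ l + 1) := hC0 ▸ hCmono (Nat.zero_le _)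
      have h3 : C (σ l + 1) ≤ 1 := hC1 ▸ hCmono (by omega)
      have h4 : 0 ≤ C j := hC0 ▸ hCmono (Nat.zero_le _)
      split_ifs with h
      · have h5 : C (σ l + 1) ≤ C j := hCmono (by omega)
        push_cast
        constructor <;> linarith
      · have h5 : C (j + 1) ≤ C (σ l + 1) := hCmono (by omega)
        push_cast
        constructor <;> linarith
    · rw [hsupp v fun h => hv (hsσ h)]
      exact baryWeight_nonneg k x v
  refine ⟨x, ?_⟩
  have hsum2 : ∑ v, z v = ∑ v, baryWeight k x v := by
    rw [sum_baryWeight, ← hsum]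
    exact (Finset.sum_subset (Finset.subset_univ _) fun v _ hv => hsupp v hv).symm
  ext v
  exact ((Finset.sum_eq_sum_iff_of_le fun v _ => hle v).1 hsum2 v (Finset.mem_univ v)).symm

/-! ### The homeomorphism with the torus -/

/-- The matrix `M_k` with real entries. -/
noncomputable def realM (k : Fin (d + 1) → ℕ) : Matrix (Fin (d + 1)) (Fin (d + 1)) ℝ :=
  (M k).map (Int.cast : ℤ → ℝ)

theorem isUnit_realM (hd : 1 ≤ d) {k : Fin (d + 1) → ℕ} (hk : ∀ i, 0 < k i) : IsUnit (realM k) := by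
  rw [Matrix.isUnit_iff_isUnit_det]
  have : (realM k).det = (D k : ℝ) := (Int.cast_det (M k)).symm
  rw [this, isUnit_iff_ne_zero]
  exact_mod_cast (D_pos hd hk).ne'

theorem vecMul_realM_int (k : Fin (d + 1) → ℕ) (b : Fin (d + 1) → ℤ) :
    Matrix.vecMul (fun i => (b i : ℝ)) (realM k) =
      fun i => ((Matrix.vecMul b (M k) i : ℤ) : ℝ) := by
  ext i
  simp [Matrix.vecMul, dotProduct, realM]

theorem vecMul_realM_const (hd : 1 ≤ d) (k : Fin (d + 1) → ℕ) (c : ℝ) :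
    Matrix.vecMul (fun _ => c) (realM k) = fun _ => c := by
  have h1 := vecMul_realM_int k fun _ => 1
  have h2 : (fun _ : Fin (d + 1) => c) = c • fun _ => ((1 : ℤ) : ℝ) := by
    ext; simp
  rw [h2, Matrix.smul_vecMul, h1]
  ext i
  simp [vecMul_M hd]

theorem coe_eq_coe_iff_exists_int {s t : ℝ} :
    (s : UnitAddCircle) = t ↔ ∃ m : ℤ, s = t + m := by
  rw [← sub_eq_zero, ← AddCircle.coe_sub, AddCircle.coe_eq_zero_iff]
  constructor
  · rintro ⟨m, hm⟩
    exact ⟨m, by simp at hm; linarith⟩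
  · rintro ⟨m, hm⟩
    exact ⟨m, by simp; linarith⟩

/-- Writing points in the basis of the rows of the matrix, the lattice becomes the standard lattice
and the direction `(1, …, 1)` is preserved, so the first coordinate may be normalized to `0`, and
the remaining ones are determined modulo the integers. -/
theorem realization_homeomorph_torus (hd : 1 ≤ d) {k : Fin (d + 1) → ℕ} (hk : ∀ i, 0 < k i) :
    Nonempty (realization (torusComplex k) ≃ₜ (Fin d → UnitAddCircle)) := by
  let Φ : (Fin d → ℝ) → realization (torusComplex k) := fun z =>
    ⟨baryWeight k (Matrix.vecMul (Fin.cons 0 z : Fin (d + 1) → ℝ) (realM k)),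
      baryWeight_mem_realization hd hk _⟩
  have hΦ : Continuous Φ := by
    refine Continuous.subtype_mk (continuous_pi fun v => (continuous_baryWeight k v).comp ?_) _
    refine Continuous.matrix_vecMul ?_ continuous_const
    refine continuous_pi fun i => ?_
    induction i using Fin.cases with
    | zero => simpa using continuous_const
    | succ i => simpa using continuous_apply i
  have hinj : Function.Injective fun y : Fin (d + 1) → ℝ => Matrix.vecMul y (realM k) :=
    Matrix.vecMul_injective_of_isUnit (isUnit_realM hd hk)
  have hsurj : Function.Surjective Φ := by
    rintro ⟨z, hz⟩
    obtain ⟨x, rfl⟩ := exists_baryWeight_eq hd hk hz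
    obtain ⟨y, rfl⟩ := Matrix.vecMul_surjective_iff_isUnit.2 (isUnit_realM hd hk) x
    refine ⟨fun i => y i.succ - y 0, Subtype.ext ?_⟩
    have h1 : (Fin.cons 0 fun i => y i.succ - y 0 : Fin (d + 1) → ℝ) = y + fun _ => - y 0 := by
      ext i
      induction i using Fin.cases with
      | zero => simp
      | succ i => simp [sub_eq_add_neg]
    change baryWeight k (Matrix.vecMul _ _) = _
    rw [h1, Matrix.add_vecMul, vecMul_realM_const hd, baryWeight_add_const hd]
  have hfib : ∀ z z', Φ z = Φ z' ↔ ∀ i, (z i : UnitAddCircle) = z' i := by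
    intro z z'
    constructor
    · intro h
      obtain ⟨a, ha, c, hac⟩ := exists_of_baryWeight_eq hd hk (congrArg Subtype.val h)
      obtain ⟨b, rfl⟩ := mem_rowLattice.1 ha
      have h1 : (Fin.cons 0 z : Fin (d + 1) → ℝ) =
          (Fin.cons 0 z' : Fin (d + 1) → ℝ) + (fun i => (b i : ℝ)) + fun _ => c := by
        apply hinj
        simp only
        rw [Matrix.add_vecMul, Matrix.add_vecMul, vecMul_realM_int, vecMul_realM_const hd]
        exact funext hac
      intro i
      have h2 := congrFun h1 0
      have h3 := congrFun h1 i.succ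
      simp at h2 h3
      refine coe_eq_coe_iff_exists_int.2 ⟨b i.succ - b 0, ?_⟩
      push_cast
      linarith
    · intro h
      choose m hm using fun i => coe_eq_coe_iff_exists_int.1 (h i)
      have h1 : (Fin.cons 0 z : Fin (d + 1) → ℝ) = (Fin.cons 0 z' : Fin (d + 1) → ℝ) +
          fun i => ((Fin.cons 0 m : Fin (d + 1) → ℤ) i : ℝ) := by
        ext i
        induction i using Fin.cases with
        | zero => simp
        | succ i => simp [hm]
      refine Subtype.ext ?_
      change baryWeight k (Matrix.vecMul _ _) = baryWeight k (Matrix.vecMul _ _)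
      rw [h1, Matrix.add_vecMul, vecMul_realM_int,
        baryWeight_add_rowLattice hd _ (mem_rowLattice.2 ⟨_, rfl⟩)]
  let π : (Fin d → ℝ) → (Fin d → UnitAddCircle) := Pi.map fun _ => QuotientAddGroup.mk
  have hquot : IsOpenQuotientMap π :=
    IsOpenQuotientMap.piMap fun _ => QuotientAddGroup.isOpenQuotientMap_mk
  have hfac : ∀ z z', π z = π z' → Φ z = Φ z' := fun z z' h => (hfib z z').2 fun i => congrFun h i
  let πc : C(Fin d → ℝ, Fin d → UnitAddCircle) := ⟨π, hquot.continuous⟩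
  have hπc : IsQuotientMap πc := hquot.isQuotientMap
  let Ψ : C(Fin d → UnitAddCircle, realization (torusComplex k)) :=
    hπc.lift ⟨Φ, hΦ⟩ fun z z' h => hfac z z' h
  have hΨ : ∀ z, Ψ (π z) = Φ z :=
    fun z => DFunLike.congr_fun (hπc.lift_comp ⟨Φ, hΦ⟩ fun z z' h => hfac z z' h) z
  have hbij : Function.Bijective Ψ := by
    constructor
    · intro u u' h
      obtain ⟨z, rfl⟩ := hquot.surjective u
      obtain ⟨z', rfl⟩ := hquot.surjective u'
      rw [hΨ, hΨ] at h
      exact funext fun i => (hfib z z').1 h i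
    · intro p
      obtain ⟨z, rfl⟩ := hsurj p
      exact ⟨_, hΨ z⟩
  exact ⟨(Continuous.homeoOfEquivCompactToT2 (f := Equiv.ofBijective Ψ hbij) Ψ.continuous).symm⟩

end Heawood

theorem mainTheorem1 (d : ℕ) (hd : 2 ≤ d) (k : Fin (d + 1) → ℕ) (hk : ∀ i, 0 < k i) :
    -- the classes of faces of the affine complex form the simplicial complex `T_k`
    (∀ F ∈ (affineComplex d).faces,
      Set.InjOn (toTorus k) (F : Set (weightLattice d))) ∧
    (∀ F ∈ (affineComplex d).faces, ∀ G ∈ (affineComplex d).faces,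
      toTorus k '' (F : Set (weightLattice d)) = toTorus k '' (G : Set (weightLattice d)) ↔
        FaceEquiv k F G) ∧
    -- `T_k` is finite, and it triangulates the `d`-dimensional torus
    Finite (TorusVertex k) ∧
    Nonempty (realization (torusComplex k) ≃ₜ (Fin d → UnitAddCircle)) ∧
    -- `H_k` is the dual graph of `T_k`
    (∃ (φ : HeawoodVertex k ≃ Facet (torusComplex k))
      (ψ : HeawoodEdge k ≃ (dualGraph (torusComplex k)).edgeSet),
      ∀ e x y, (heawoodGraph k).IsLink e x y ↔ (ψ e : Sym2 _) = s(φ x, φ y)) ∧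
    -- the `f`-vector of `T_k`
    D k = ∏ i, ((k i : ℤ) + 1) - ∏ i, (k i : ℤ) ∧
    (∀ F ∈ (torusComplex k).faces, F.card ≤ d + 1) ∧
    (∀ i ≤ d, (fVector (torusComplex k) i : ℤ) =
      (Nat.factorial i : ℤ) * (Nat.stirlingSecond (d + 1) (i + 1) : ℤ) * D k) ∧
    (fVector (torusComplex k) 0 : ℤ) = D k ∧
    (fVector (torusComplex k) (d - 1) : ℚ) = (Nat.factorial (d + 1) : ℚ) / 2 * (D k : ℚ) ∧
    (fVector (torusComplex k) d : ℤ) = (Nat.factorial d : ℤ) * D k := by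
  have hd' : 1 ≤ d := by omega
  have h0 := fVector_eq hd' hk 0
  have hdd := fVector_eq hd' hk d
  rw [Nat.stirlingSecond_one_right] at h0
  rw [Nat.stirlingSecond_self] at hdd
  exact ⟨fun F hF => injOn_toTorus hd' hk hF,
    fun F hF G hG => image_toTorus_eq_iff hd' hk hF hG,
    finite_torusVertex hd' hk,
    realization_homeomorph_torus hd' hk,
    exists_heawood_iso_dual hd hk,
    D_eq hd' k,
    fun F hF => card_le_of_mem_torusComplex hd' hk hF,
    fun i _ => fVector_eq hd' hk i,
    by simpa using h0,
    fVector_codim_one hd' hk,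
    by simpa using hdd⟩
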